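/- Let $\mathbf k$ be a field. **Trees and configurations.** All trees are planar rooted trees whose vertices have at least one input; the trivial tree (one leaf, no vertex) is included. For a tree $\tau$ whose leaves carry distinct labels, let $\mathrm{Lin}(\tau)$ be its set of leaf labels. For $J\subseteq \mathrm{Lin}(\tau)$ and a vertex $\omega$ of $\tau$ of arity $\ell$, with branches $\tau_1,\dots,\tau_\ell$ above it, put $J\sqcap\omega=\{i\in[\ell] : J\cap \mathrm{Lin}(\tau_i)\neq\emptyset\}$. A *configuration* is a sequence $\mathcal C=(C_n)_{n\ge1}$, with $C_n$ a set of nonempty subsets of $[n]=\{1,\dots,n\}$, such that for every $n$, every $J\in C_n$, every tree $\tau$ with $n$ leaves (numbered from left to right) and every vertex $\omega$ of $\tau$ of arity $\ell$, $J\sqcap\omega\neq\emptyset$ implies $J\sqcap\omega\in C_\ell$. It is *$\mathbb S$-invariant* if each $C_n$ is stable under $\mathbb S_n$. Its *index* is $\sup\{n\ge 1 : C_n \text{ consists of all nonempty subsets of } [n]\}\in\{1,2,\dots,\infty\}$, which exists if this set of $n$ is nonempty. Let $\mathcal A$ be the configuration with $A_n=\{\{1\},\dots,\{n\}\}$. **Splittings.**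 Let $V=\bigoplus_{n\ge1}V(n)$ be an $\mathbb S$-module over $\mathbf k$, $\mathcal T(V)$ the free (symmetric) operad on $V$, $R$ a set of locally homogeneous relations, i.e. each $r\in R$ is a formal linear combination $r=\sum_i c_i\tau_i$ of trees with vertices decorated by elements of $V$ (a vertex of arity $\ell$ by an element of $V(\ell)$) and with leaves labelled bijectively by one and the same set $[n]=\mathrm{Lin}(r)$, and let $\mathcal P=\mathcal T(V)/(R)$. Let $\mathcal C$ be an $\mathbb S$-invariant configuration. Let $\mathcal C\mathrm{Sp}(V)$ be the $\mathbb S$-module with $\mathcal C\mathrm{Sp}(V)(n)=V(n)\otimes\bigoplus_{I\in C_n}\mathbf k e_I$ and $\sigma\cdot(\omega\otimes e_I)=(\sigma\cdot\omega)\otimes e_{\sigma(I)}$, where $(\sigma\cdot\omega)(x_1,\dots,x_n)=\omega(x_{\sigma(1)},\dots,x_{\sigma(n)})$. Write $(\omega,e_I)=\omega\otimes e_I$ for $I\in C_n$, with the convention $(\omega,e_I)=0$ for $I\notin C_n$, and $(\omega,*)=\sum_{I\in C_n}(\omega,e_I)$. For a decorated tree $\tau$ let $\mathcal C\mathrm{Sp}_\emptyset(\tau)$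 be obtained by replacing each decoration $\omega$ by $(\omega,*)$. For $\emptyset\ne J\subseteq\mathrm{Lin}(\tau)$, let $\mathcal C\mathrm{Sp}_J(\tau)=\tau$ if $\tau$ is trivial, and, if $\tau$ has root $\omega$ and branches $\tau_1,\dots,\tau_\ell$, let $\mathcal C\mathrm{Sp}_J(\tau)$ be the tree with root $(\omega,e_{J\sqcap\omega})$ and branches $\mathcal C\mathrm{Sp}_{J\cap\mathrm{Lin}(\tau_i)}(\tau_i)$; extend linearly to linear combinations of trees. The *$\mathcal C$-splitting* of $\mathcal P$ is $\mathcal C\mathrm{Sp}(\mathcal P)=\mathcal T(\mathcal C\mathrm{Sp}(V))/(\mathcal C\mathrm{Sp}_J(r) : r\in R,\ J\in C_{|\mathrm{Lin}(r)|})$; for $\mathcal C=\mathcal A$ it is called the *arity-splitting*. A family of linear maps $f_n\colon V(n)\to\mathcal C\mathrm{Sp}(V)(n)$ *induces* an operad morphism $\varphi\colon\mathcal P\to\mathcal C\mathrm{Sp}(\mathcal P)$ if, for all $n\ge 1$ and $\omega\in V(n)$, $\varphi$ maps the class of $\omega$ in $\mathcal P$ to the class of $f_n(\omega)$ in $\mathcal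 C\mathrm{Sp}(\mathcal P)$. **Theorem.** 1. The map $\omega\mapsto\sum_{i\in[n]}(\omega,e_{\{i\}})$, $\omega\in V(n)$, $n\ge 1$, induces a unique operad morphism $\mathcal P\to\mathcal A\mathrm{Sp}(\mathcal P)$. Let moreover $\mathcal C$ be an $\mathbb S$-invariant configuration with index $m$ $(1\le m\le\infty)$, and suppose $|\mathrm{Lin}(r)|\le m$ for all $r\in R$. 2. The map $\omega\mapsto\sum_{\emptyset\ne I\subseteq[n]}(\omega,e_I)$, $\omega\in V(n)$, $n\ge 1$ (that is, $\omega\mapsto(\omega,*)$), induces a unique operad morphism $\mathcal P\to\mathcal C\mathrm{Sp}(\mathcal P)$. 3. The map $\omega\mapsto(\omega,e_{[n]})$, $\omega\in V(n)$, $n\ge 1$, induces a unique operad morphism $\mathcal P\to\mathcal C\mathrm{Sp}(\mathcal P)$. -/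

import Mathlib

universe u v w w'

noncomputable section

/-- A symmetric operad in `k`-modules, in the coordinate-free form: a functor `obj` from finite sets
and bijections to `k`-modules (so `obj (Fin n)`, with the action of the permutations of `Fin n`
given by `map`, is the component of arity `n`), a unit, and multilinear composition maps
`obj I ⊗ ⨂ i, obj (J i) → obj (Σ i, J i)` which are natural, unital and associative. -/
structure Operad (k : Type v) [CommRing k] where
  obj : (X : Type) → [Finite X] → Type w
  [instAddCommGroup : ∀ (X : Type) [Finite X], AddCommGroup (obj X)]
  [instModule : ∀ (X : Type) [Finite X], Module k (obj X)]
  map : {X Y : Type} → [Finite X] → [Finite Y] → (X ≃ Y) → obj X →ₗ[k] obj Y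
  one : obj Unit
  comp : {I : Type} → [Finite I] → {J : I → Type} → [∀ i, Finite (J i)] →
    obj I →ₗ[k] MultilinearMap k (fun i => obj (J i)) (obj (Σ i, J i))
  map_refl : ∀ {X : Type} [Finite X] (p : obj X), map (Equiv.refl X) p = p
  map_map : ∀ {X Y Z : Type} [Finite X] [Finite Y] [Finite Z] (e : X ≃ Y) (f : Y ≃ Z) (p : obj X),
    map f (map e p) = map (e.trans f) p
  map_comp : ∀ {I : Type} [Finite I] {J J' : I → Type} [∀ i, Finite (J i)] [∀ i, Finite (J' i)]
    (e : ∀ i, J i ≃ J' i) (p : obj I) (q : ∀ i, obj (J i)),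
    map (Equiv.sigmaCongrRight e) (comp p q) = comp p (fun i => map (e i) (q i))
  comp_map : ∀ {I I' : Type} [Finite I] [Finite I'] (e : I ≃ I') {J : I' → Type}
    [∀ i, Finite (J i)] (p : obj I) (q : ∀ i, obj (J i)),
    map (Equiv.sigmaCongrLeft e) (comp p (fun i => q (e i))) = comp (map e p) q
  one_comp : ∀ {X : Type} [Finite X] (p : obj X),
    map (Equiv.uniqueSigma (fun _ : Unit => X)) (comp one (fun _ => p)) = p
  comp_one : ∀ {X : Type} [Finite X] (p : obj X),
    map (Equiv.sigmaUnique X (fun _ => Unit)) (comp p (fun _ => one)) = p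
  assoc : ∀ {I : Type} [Finite I] {J : I → Type} [∀ i, Finite (J i)] {K : ∀ i, J i → Type}
    [∀ i j, Finite (K i j)] (p : obj I) (q : ∀ i, obj (J i)) (r : ∀ i j, obj (K i j)),
    map (Equiv.sigmaAssoc K) (comp (comp p q) (fun x : (Σ i, J i) => r x.1 x.2)) =
      comp p (fun i => comp (q i) (r i))

attribute [instance] Operad.instAddCommGroup Operad.instModule

namespace Operad

variable {k : Type v} [CommRing k]

/-- Morphisms of operads. -/
@[ext]
structure Hom (P : Operad.{v, w} k) (Q : Operad.{v, w'} k) where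
  app : (X : Type) → [Finite X] → P.obj X →ₗ[k] Q.obj X
  app_map : ∀ {X Y : Type} [Finite X] [Finite Y] (e : X ≃ Y) (p : P.obj X),
    app Y (P.map e p) = Q.map e (app X p)
  app_one : app Unit P.one = Q.one
  app_comp : ∀ {I : Type} [Finite I] {J : I → Type} [∀ i, Finite (J i)]
    (p : P.obj I) (q : ∀ i, P.obj (J i)),
    app (Σ i, J i) (P.comp p q) = Q.comp (app I p) (fun i => app (J i) (q i))

/-- Operadic ideals. -/
structure OpIdeal (P : Operad.{v, w} k) where
  sub : (X : Type) → [Finite X] → Submodule k (P.obj X)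
  map_mem : ∀ {X Y : Type} [Finite X] [Finite Y] (e : X ≃ Y) (p : P.obj X),
    p ∈ sub X → P.map e p ∈ sub Y
  comp_mem_left : ∀ {I : Type} [Finite I] {J : I → Type} [∀ i, Finite (J i)]
    (p : P.obj I) (q : ∀ i, P.obj (J i)), p ∈ sub I → P.comp p q ∈ sub (Σ i, J i)
  comp_mem_right : ∀ {I : Type} [Finite I] {J : I → Type} [∀ i, Finite (J i)]
    (p : P.obj I) (q : ∀ i, P.obj (J i)) (i : I), q i ∈ sub (J i) → P.comp p q ∈ sub (Σ i, J i)

namespace OpIdeal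

variable {P : Operad.{v, w} k}

/-- The smallest operadic ideal that contains the given sets of operations of arity `n ≥ 1`. -/
def span (S : ∀ n : ℕ+, Set (P.obj (Fin n))) : OpIdeal P where
  sub X _ :=
    { carrier := {p | ∀ A : OpIdeal P, (∀ n, S n ⊆ A.sub (Fin n)) → p ∈ A.sub X}
      add_mem' := fun ha hb A hA => add_mem (ha A hA) (hb A hA)
      zero_mem' := fun A _ => zero_mem (A.sub X)
      smul_mem' := fun c _ ha A hA => (A.sub X).smul_mem c (ha A hA) }
  map_mem e p hp A hA := A.map_mem e p (hp A hA)
  comp_mem_left p q hp A hA := A.comp_mem_left p q (hp A hA)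
  comp_mem_right p q i hq A hA := A.comp_mem_right p q i (hq A hA)

variable (A : OpIdeal P)

theorem comp_sub_mem {I : Type} [Finite I] {J : I → Type} [∀ i, Finite (J i)]
    (p p' : P.obj I) (q q' : ∀ i, P.obj (J i)) (hp : p - p' ∈ A.sub I)
    (hq : ∀ i, q i - q' i ∈ A.sub (J i)) :
    P.comp p q - P.comp p' q' ∈ A.sub (Σ i, J i) := by
  classical
  have h1 : P.comp p q - P.comp p' q ∈ A.sub (Σ i, J i) := by
    have := A.comp_mem_left (p - p') q hp
    simpa using this
  have key : ∀ s : Finset I, P.comp p' q - P.comp p' (s.piecewise q' q) ∈ A.sub (Σ i, J i) := by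
    intro s
    induction s using Finset.induction_on with
    | empty => simp
    | insert a s ha ih =>
      have h2 : P.comp p' (s.piecewise q' q) - P.comp p' ((insert a s).piecewise q' q)
          ∈ A.sub (Σ i, J i) := by
        have e1 : s.piecewise q' q = Function.update (s.piecewise q' q) a (q a) := by
          rw [eq_comm, Function.update_eq_self_iff]
          simp [ha]
        rw [Finset.piecewise_insert]
        nth_rewrite 1 [e1]
        rw [← MultilinearMap.map_update_sub]
        apply A.comp_mem_right _ _ a
        simpa using hq a
      have := add_mem ih h2
      simpa using this
  cases nonempty_fintype I
  have h3 := key Finset.univ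
  rw [Finset.piecewise_univ] at h3
  simpa using add_mem h1 h3

/-- The component of the quotient operad. -/
abbrev Quo (X : Type) [Finite X] : Type w := P.obj X ⧸ A.sub X

/-- The class of an operation in the quotient. -/
abbrev cls {X : Type} [Finite X] (p : P.obj X) : A.Quo X := Submodule.Quotient.mk p

/-- A representative of a class. -/
def rep {X : Type} [Finite X] (p : A.Quo X) : P.obj X :=
  (Submodule.Quotient.mk_surjective (A.sub X) p).choose

theorem cls_rep {X : Type} [Finite X] (p : A.Quo X) : A.cls (A.rep p) = p :=
  (Submodule.Quotient.mk_surjective (A.sub X) p).choose_spec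

theorem exists_cls {I : Type} {J : I → Type} [∀ i, Finite (J i)] (q : ∀ i, A.Quo (J i)) :
    ∃ q' : ∀ i, P.obj (J i), q = fun i => A.cls (q' i) :=
  ⟨fun i => A.rep (q i), funext fun i => (A.cls_rep (q i)).symm⟩

theorem cls_comp_rep {I : Type} [Finite I] {J : I → Type} [∀ i, Finite (J i)]
    (p : P.obj I) (q : ∀ i, P.obj (J i)) :
    A.cls (P.comp (A.rep (A.cls p)) (fun i => A.rep (A.cls (q i)))) = A.cls (P.comp p q) := by
  rw [Submodule.Quotient.eq]
  apply A.comp_sub_mem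
  · rw [← Submodule.Quotient.eq]; exact A.cls_rep _
  · intro i; rw [← Submodule.Quotient.eq]; exact A.cls_rep _

theorem update_cls {I : Type} [DecidableEq I] {J : I → Type} [∀ i, Finite (J i)]
    (q : ∀ i, P.obj (J i)) (i : I) (x : P.obj (J i)) :
    Function.update (fun i => A.cls (q i)) i (A.cls x) =
      fun j => A.cls (Function.update q i x j) := by
  funext j
  rcases eq_or_ne j i with rfl | h
  · simp
  · simp [h]

/-- The composition of the quotient operad, computed on representatives. -/
def quoComp {I : Type} [Finite I] {J : I → Type} [∀ i, Finite (J i)] :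
    A.Quo I →ₗ[k] MultilinearMap k (fun i => A.Quo (J i)) (A.Quo (Σ i, J i)) where
  toFun p :=
    { toFun := fun q => A.cls (P.comp (A.rep p) (fun i => A.rep (q i)))
      map_update_add' := by
        intro _ q i x y
        obtain ⟨q, rfl⟩ := A.exists_cls q
        obtain ⟨p, rfl⟩ := Submodule.Quotient.mk_surjective _ p
        obtain ⟨x, rfl⟩ := Submodule.Quotient.mk_surjective _ x
        obtain ⟨y, rfl⟩ := Submodule.Quotient.mk_surjective _ y
        change A.cls (P.comp _ (fun j => A.rep (Function.update (fun i => A.cls (q i)) i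
          (A.cls (x + y)) j))) = _
        simp only [update_cls, cls_comp_rep, MultilinearMap.map_update_add]
        rfl
      map_update_smul' := by
        intro _ q i c x
        obtain ⟨q, rfl⟩ := A.exists_cls q
        obtain ⟨p, rfl⟩ := Submodule.Quotient.mk_surjective _ p
        obtain ⟨x, rfl⟩ := Submodule.Quotient.mk_surjective _ x
        change A.cls (P.comp _ (fun j => A.rep (Function.update (fun i => A.cls (q i)) i
          (A.cls (c • x)) j))) = _
        simp only [update_cls, cls_comp_rep, MultilinearMap.map_update_smul]
        rfl }
  map_add' p p' := by
    ext q
    obtain ⟨q, rfl⟩ := A.exists_cls q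
    obtain ⟨p, rfl⟩ := Submodule.Quotient.mk_surjective _ p
    obtain ⟨p', rfl⟩ := Submodule.Quotient.mk_surjective _ p'
    change A.cls (P.comp (A.rep (A.cls (p + p'))) (fun i => A.rep (A.cls (q i)))) =
      A.cls (P.comp (A.rep (A.cls p)) (fun i => A.rep (A.cls (q i)))) +
        A.cls (P.comp (A.rep (A.cls p')) (fun i => A.rep (A.cls (q i))))
    simp only [cls_comp_rep, map_add]
    rfl
  map_smul' c p := by
    ext q
    obtain ⟨q, rfl⟩ := A.exists_cls q
    obtain ⟨p, rfl⟩ := Submodule.Quotient.mk_surjective _ p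
    change A.cls (P.comp (A.rep (A.cls (c • p))) (fun i => A.rep (A.cls (q i)))) =
      c • A.cls (P.comp (A.rep (A.cls p)) (fun i => A.rep (A.cls (q i))))
    simp only [cls_comp_rep, map_smul]
    rfl

theorem quoComp_cls {I : Type} [Finite I] {J : I → Type} [∀ i, Finite (J i)]
    (p : P.obj I) (q : ∀ i, P.obj (J i)) :
    A.quoComp (A.cls p) (fun i => A.cls (q i)) = A.cls (P.comp p q) :=
  A.cls_comp_rep p q

/-- The transport of structure of the quotient operad. -/
def quoMap {X Y : Type} [Finite X] [Finite Y] (e : X ≃ Y) : A.Quo X →ₗ[k] A.Quo Y :=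
  Submodule.mapQ (A.sub X) (A.sub Y) (P.map e) (fun p hp => A.map_mem e p hp)

theorem quoMap_cls {X Y : Type} [Finite X] [Finite Y] (e : X ≃ Y) (p : P.obj X) :
    A.quoMap e (A.cls p) = A.cls (P.map e p) := rfl

/-- The quotient of an operad by an operadic ideal. -/
def quotient : Operad.{v, w} k where
  obj X _ := A.Quo X
  map e := A.quoMap e
  one := A.cls P.one
  comp := A.quoComp
  map_refl p := by
    obtain ⟨p, rfl⟩ := Submodule.Quotient.mk_surjective _ p
    rw [quoMap_cls, P.map_refl]
  map_map e f p := by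
    obtain ⟨p, rfl⟩ := Submodule.Quotient.mk_surjective _ p
    rw [quoMap_cls, quoMap_cls, quoMap_cls, P.map_map]
  map_comp e p q := by
    obtain ⟨p, rfl⟩ := Submodule.Quotient.mk_surjective _ p
    obtain ⟨q, rfl⟩ := A.exists_cls q
    simp only [quoComp_cls, quoMap_cls, P.map_comp]
  comp_map e _ _ p q := by
    obtain ⟨p, rfl⟩ := Submodule.Quotient.mk_surjective _ p
    obtain ⟨q, rfl⟩ := A.exists_cls q
    rw [A.quoComp_cls p (fun i => q (e i)), quoMap_cls, quoMap_cls, quoComp_cls, P.comp_map]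
  one_comp p := by
    obtain ⟨p, rfl⟩ := Submodule.Quotient.mk_surjective _ p
    rw [A.quoComp_cls P.one (fun _ => p), quoMap_cls, P.one_comp]
  comp_one p := by
    obtain ⟨p, rfl⟩ := Submodule.Quotient.mk_surjective _ p
    rw [A.quoComp_cls p (fun _ => P.one), quoMap_cls, P.comp_one]
  assoc p q r := by
    obtain ⟨p, rfl⟩ := Submodule.Quotient.mk_surjective _ p
    obtain ⟨q, rfl⟩ := A.exists_cls q
    choose r' hr using fun i => A.exists_cls (r i)
    obtain rfl : r = fun i j => A.cls (r' i j) := funext hr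
    rw [quoComp_cls, A.quoComp_cls (P.comp p q) (fun x => r' x.1 x.2), quoMap_cls, P.assoc]
    simp only [quoComp_cls]

/-- The projection to the quotient. -/
def proj : Hom P A.quotient where
  app X _ := (A.sub X).mkQ
  app_map _ _ := rfl
  app_one := rfl
  app_comp p q := (A.quoComp_cls p q).symm

end OpIdeal

end Operad

/-! ### Planar trees -/

/-- Planar rooted trees whose vertices have at least one input, with the vertices of arity `n`
decorated by `Ω n` and the leaves labelled by `X`. -/
inductive PTree (Ω : ℕ+ → Type u) (X : Type) : Type u
  | leaf : X → PTree Ω X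
  | node : (n : ℕ+) → Ω n → (Fin n → PTree Ω X) → PTree Ω X

namespace PTree

variable {Ω : ℕ+ → Type u} {X Y Z : Type}

/-- The labels of the leaves, from the left to the right. -/
def leaves : PTree Ω X → List X
  | leaf x => [x]
  | node n _ c => (List.finRange n).flatMap (fun i => (c i).leaves)

/-- Grafting of the tree `f x` on each leaf labelled `x`. -/
def bind : PTree Ω X → (X → PTree Ω Y) → PTree Ω Y
  | leaf x, f => f x
  | node n v c, f => node n v (fun i => (c i).bind f)

/-- Relabelling of the leaves. -/
def relabel (f : X → Y) (t : PTree Ω X) : PTree Ω Y := t.bind (fun x => leaf (f x))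

/-- Each element of `X` labels exactly one leaf. -/
def Labelled (t : PTree Ω X) : Prop := t.leaves.Nodup ∧ ∀ x, x ∈ t.leaves

/-- `Subtree s t`: `s` consists of a vertex or leaf of `t` and all that lies above it. -/
inductive Subtree : PTree Ω X → PTree Ω X → Prop
  | refl (t : PTree Ω X) : Subtree t t
  | child (s : PTree Ω X) (n : ℕ+) (v : Ω n) (c : Fin n → PTree Ω X) (i : Fin n) :
      Subtree s (c i) → Subtree s (node n v c)

open Classical in
/-- The set `J ⊓ ω` of those inputs of a vertex `ω`, with branches `c`, above which there is a leaf
with label in `J`. -/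
def meet (J : Finset X) {n : ℕ+} (c : Fin n → PTree Ω X) : Finset (Fin n) :=
  Finset.univ.filter (fun i => ∃ x ∈ (c i).leaves, x ∈ J)

theorem bind_leaf (t : PTree Ω X) : t.bind leaf = t := by
  induction t with
  | leaf x => rfl
  | node n v c ih => simp only [bind, ih]

theorem bind_bind (t : PTree Ω X) (f : X → PTree Ω Y) (g : Y → PTree Ω Z) :
    (t.bind f).bind g = t.bind (fun x => (f x).bind g) := by
  induction t with
  | leaf x => rfl
  | node n v c ih => simp only [bind, ih]

theorem leaves_bind (t : PTree Ω X) (f : X → PTree Ω Y) :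
    (t.bind f).leaves = t.leaves.flatMap (fun x => (f x).leaves) := by
  induction t with
  | leaf x => simp [bind, leaves]
  | node n v c ih => simp only [bind, leaves, ih, List.flatMap_assoc]

theorem leaves_relabel (f : X → Y) (t : PTree Ω X) : (t.relabel f).leaves = t.leaves.map f := by
  simp only [relabel, leaves_bind, leaves]
  exact List.flatMap_pure_eq_map f t.leaves

theorem Labelled.relabel {t : PTree Ω X} (h : t.Labelled) (e : X ≃ Y) :
    (t.relabel e).Labelled := by
  constructor
  · rw [leaves_relabel]; exact h.1.map e.injective
  · intro y; rw [leaves_relabel, List.mem_map]; exact ⟨e.symm y, h.2 _, by simp⟩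

/-- Grafting of the tree `b i` on the leaf labelled `i`, the new leaves being labelled by pairs. -/
def graft {I : Type} {J : I → Type} (t : PTree Ω I) (b : ∀ i, PTree Ω (J i)) :
    PTree Ω (Σ i, J i) :=
  t.bind (fun i => (b i).relabel (Sigma.mk i))

theorem Labelled.graft {I : Type} {J : I → Type} {t : PTree Ω I} {b : ∀ i, PTree Ω (J i)}
    (ht : t.Labelled) (hb : ∀ i, (b i).Labelled) : (t.graft b).Labelled := by
  constructor
  · rw [PTree.graft, leaves_bind, List.nodup_flatMap]
    constructor
    · intro i _
      rw [leaves_relabel]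
      exact (hb i).1.map sigma_mk_injective
    · refine ht.1.imp ?_
      intro i i' hne
      simp only [Function.onFun, leaves_relabel]
      intro x hx hx'
      rw [List.mem_map] at hx hx'
      obtain ⟨j, _, rfl⟩ := hx
      obtain ⟨j', _, h⟩ := hx'
      exact hne (congrArg Sigma.fst h).symm
  · rintro ⟨i, j⟩
    rw [PTree.graft, leaves_bind, List.mem_flatMap]
    refine ⟨i, ht.2 i, ?_⟩
    rw [leaves_relabel, List.mem_map]
    exact ⟨j, (hb i).2 j, rfl⟩

theorem Subtree.nodup {s t : PTree Ω X} (h : Subtree s t) (ht : t.leaves.Nodup) :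
    s.leaves.Nodup := by
  induction h with
  | refl => exact ht
  | child n v c i _ ih =>
    apply ih
    rw [leaves, List.nodup_flatMap] at ht
    exact ht.1 i (List.mem_finRange i)

/-- The tree with a single vertex, its inputs being labelled from the left to the right. -/
def corolla (n : ℕ+) (v : Ω n) : PTree Ω (Fin n) := node n v leaf

theorem labelled_corolla (n : ℕ+) (v : Ω n) : (corolla n v).Labelled := by
  simp [Labelled, corolla, leaves, List.flatMap_singleton', List.nodup_finRange]

end PTree

/-- Decorated trees whose leaves are labelled bijectively by `X`. -/
def LTree (Ω : ℕ+ → Type u) (X : Type) : Type u := {t : PTree Ω X // t.Labelled}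

namespace LTree

variable {Ω : ℕ+ → Type u}

def relabel {X Y : Type} (e : X ≃ Y) (t : LTree Ω X) : LTree Ω Y :=
  ⟨t.1.relabel e, t.2.relabel e⟩

def graft {I : Type} {J : I → Type} (t : LTree Ω I) (b : ∀ i, LTree Ω (J i)) :
    LTree Ω (Σ i, J i) :=
  ⟨t.1.graft (fun i => (b i).1), t.2.graft (fun i => (b i).2)⟩

/-- The trivial tree. -/
def triv : LTree Ω Unit := ⟨PTree.leaf (), by simp [PTree.Labelled, PTree.leaves]⟩

def corolla (n : ℕ+) (v : Ω n) : LTree Ω (Fin n) := ⟨PTree.corolla n v, PTree.labelled_corolla n v⟩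

theorem relabel_refl {X : Type} (t : LTree Ω X) : t.relabel (Equiv.refl X) = t :=
  Subtype.ext (PTree.bind_leaf t.1)

theorem relabel_relabel {X Y Z : Type} (e : X ≃ Y) (f : Y ≃ Z) (t : LTree Ω X) :
    (t.relabel e).relabel f = t.relabel (e.trans f) :=
  Subtype.ext (by simp [relabel, PTree.relabel, PTree.bind_bind, PTree.bind])

theorem relabel_graft {I : Type} {J J' : I → Type} (e : ∀ i, J i ≃ J' i) (t : LTree Ω I)
    (b : ∀ i, LTree Ω (J i)) :
    (t.graft b).relabel (Equiv.sigmaCongrRight e) = t.graft (fun i => (b i).relabel (e i)) :=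
  Subtype.ext (by
    simp [relabel, graft, PTree.graft, PTree.relabel, PTree.bind_bind, PTree.bind])

theorem graft_relabel {I I' : Type} (e : I ≃ I') {J : I' → Type} (t : LTree Ω I)
    (b : ∀ i, LTree Ω (J i)) :
    (t.graft (fun i => b (e i))).relabel (Equiv.sigmaCongrLeft e) = (t.relabel e).graft b :=
  Subtype.ext (by
    simp [relabel, graft, PTree.graft, PTree.relabel, PTree.bind_bind, PTree.bind])

theorem triv_graft {X : Type} (t : LTree Ω X) :
    ((triv : LTree Ω Unit).graft (fun _ => t)).relabel (Equiv.uniqueSigma (fun _ : Unit => X)) = t :=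
  Subtype.ext (by
    simp only [relabel, graft, triv, PTree.graft, PTree.relabel, PTree.bind_bind, PTree.bind]
    exact PTree.bind_leaf t.1)

theorem graft_triv {X : Type} (t : LTree Ω X) :
    (t.graft (fun _ => triv)).relabel (Equiv.sigmaUnique X (fun _ => Unit)) = t :=
  Subtype.ext (by
    simp [relabel, graft, triv, PTree.graft, PTree.relabel, PTree.bind_bind, PTree.bind,
      PTree.bind_leaf])

theorem graft_assoc {I : Type} {J : I → Type} {K : ∀ i, J i → Type} (t : LTree Ω I)
    (b : ∀ i, LTree Ω (J i)) (d : ∀ i j, LTree Ω (K i j)) :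
    ((t.graft b).graft (fun x => d x.1 x.2)).relabel (Equiv.sigmaAssoc K) =
      t.graft (fun i => (b i).graft (d i)) :=
  Subtype.ext (by
    simp [relabel, graft, PTree.graft, PTree.relabel, PTree.bind_bind, PTree.bind,
      Equiv.sigmaAssoc])

end LTree

/-! ### The operad of decorated trees -/

section Multi

variable (k : Type v) [CommRing k]

open Classical in
/-- The multilinear extension of a function of several variables from sets to the free modules
on them. -/
def multiExt {I : Type} [Finite I] {B : I → Type u} {N : Type w} [AddCommGroup N] [Module k N]
    (F : (∀ i, B i) → N) : MultilinearMap k (fun i => B i →₀ k) N :=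
  letI : Fintype I := Fintype.ofFinite I
  (MultilinearMap.fromDFinsuppEquiv B k (fun b => MultilinearMap.mkPiRing k I (F b))).compLinearMap
    (fun i => (finsuppLequivDFinsupp k : (B i →₀ k) ≃ₗ[k] _).toLinearMap)

theorem multiExt_single {I : Type} [Finite I] {B : I → Type u} {N : Type w} [AddCommGroup N]
    [Module k N] (F : (∀ i, B i) → N) (b : ∀ i, B i) :
    multiExt k F (fun i => Finsupp.single (b i) 1) = F b := by
  classical
  simp [multiExt]

/-- Multilinear maps on free modules that agree on the bases are equal. -/
theorem multi_ext {I : Type} [Finite I] {B : I → Type u} {N : Type w} [AddCommGroup N]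
    [Module k N] {f g : MultilinearMap k (fun i => B i →₀ k) N}
    (h : ∀ b : ∀ i, B i, f (fun i => Finsupp.single (b i) 1) = g (fun i => Finsupp.single (b i) 1)) :
    f = g :=
  Module.Basis.ext_multilinear (fun _ => Finsupp.basisSingleOne) (by simpa using h)

/-- Evaluation of multilinear maps, as a linear map. -/
def multiEval {I : Type} {M : I → Type u} {N : Type w} [∀ i, AddCommGroup (M i)]
    [∀ i, Module k (M i)] [AddCommGroup N] [Module k N] (m : ∀ i, M i) :
    MultilinearMap k M N →ₗ[k] N where
  toFun f := f m
  map_add' _ _ := rfl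
  map_smul' _ _ := rfl

end Multi

section TreeOperad

variable (k : Type v) [CommRing k] (Ω : ℕ+ → Type u)

/-- Formal linear combinations of decorated trees with leaves labelled bijectively by `X`. -/
abbrev TreeMod (X : Type) : Type (max u v) := LTree Ω X →₀ k

variable {k Ω}

def treeMap {X Y : Type} (e : X ≃ Y) : TreeMod k Ω X →ₗ[k] TreeMod k Ω Y :=
  Finsupp.lmapDomain k k (LTree.relabel e)

/-- The multilinear extension of grafting. -/
def treeComp {I : Type} [Finite I] {J : I → Type} :
    TreeMod k Ω I →ₗ[k] MultilinearMap k (fun i => TreeMod k Ω (J i)) (TreeMod k Ω (Σ i, J i)) :=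
  Finsupp.linearCombination k
    (fun t : LTree Ω I => multiExt k (fun b => Finsupp.single (t.graft b) (1 : k)))

theorem treeMap_single {X Y : Type} (e : X ≃ Y) (t : LTree Ω X) (a : k) :
    treeMap e (Finsupp.single t a) = Finsupp.single (t.relabel e) a := by
  simp [treeMap]

theorem treeComp_single {I : Type} [Finite I] {J : I → Type} (t : LTree Ω I)
    (b : ∀ i, LTree Ω (J i)) :
    treeComp (Finsupp.single t (1 : k)) (fun i => Finsupp.single (b i) 1) =
      Finsupp.single (t.graft b) 1 := by
  simp [treeComp, multiExt_single]

theorem tree_hom_ext {X : Type} {N : Type w} [AddCommGroup N] [Module k N]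
    {f g : TreeMod k Ω X →ₗ[k] N} (h : ∀ t, f (Finsupp.single t 1) = g (Finsupp.single t 1)) :
    f = g :=
  Finsupp.lhom_ext' (fun t => LinearMap.ext_ring (h t))

theorem treeMap_comp {I : Type} [Finite I] {J J' : I → Type}
    (e : ∀ i, J i ≃ J' i) (p : TreeMod k Ω I) (q : ∀ i, TreeMod k Ω (J i)) :
    treeMap (Equiv.sigmaCongrRight e) (treeComp p q) =
      treeComp p (fun i => treeMap (e i) (q i)) := by
  have h : (treeMap (Equiv.sigmaCongrRight e)).compMultilinearMapₗ k ∘ₗ treeComp (k := k) (Ω := Ω)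
      = MultilinearMap.compLinearMapₗ (fun i => treeMap (e i)) ∘ₗ treeComp := by
    refine tree_hom_ext fun t => multi_ext k fun b => ?_
    simp [treeMap_single, treeComp_single, LTree.relabel_graft]
  exact congrArg (fun f => f p q) h

theorem treeComp_assoc {I : Type} [Finite I] {J : I → Type} [∀ i, Finite (J i)]
    {K : ∀ i, J i → Type} (p : TreeMod k Ω I) (q : ∀ i, TreeMod k Ω (J i))
    (r : ∀ i j, TreeMod k Ω (K i j)) :
    treeMap (Equiv.sigmaAssoc K) (treeComp (treeComp p q) (fun x : (Σ i, J i) => r x.1 x.2)) =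
      treeComp p (fun i => treeComp (q i) (r i)) := by
  classical
  induction p using Finsupp.induction_linear with
  | zero => simp
  | add p p' h h' => simp [h, h']
  | single t a =>
  rw [← mul_one a, ← smul_eq_mul, ← Finsupp.smul_single]
  simp only [map_smul, smul_apply]
  congr 1
  have hq : ((treeMap (Equiv.sigmaAssoc K) ∘ₗ
        multiEval k (fun x : (Σ i, J i) => r x.1 x.2) ∘ₗ treeComp).compMultilinearMap
        (treeComp (Finsupp.single t (1 : k)))) =
      (treeComp (Finsupp.single t (1 : k))).compLinearMap
        (fun i => multiEval k (r i) ∘ₗ treeComp) := by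
    refine multi_ext k fun b => ?_
    simp only [LinearMap.compMultilinearMap_apply, MultilinearMap.compLinearMap_apply,
      LinearMap.comp_apply, treeComp_single, multiEval, LinearMap.coe_mk, AddHom.coe_mk]
    let f₁ : MultilinearMap k (fun x : (Σ i, J i) => TreeMod k Ω (K x.1 x.2))
        (TreeMod k Ω (Σ i, Σ j, K i j)) :=
      (treeMap (Equiv.sigmaAssoc K)).compMultilinearMap
        (treeComp (Finsupp.single (t.graft b) (1 : k)))
    have hup : ∀ [DecidableEq (Σ i, J i)] (s : ∀ x : (Σ i, J i), TreeMod k Ω (K x.1 x.2))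
        (x : Σ i, J i) (y : TreeMod k Ω (K x.1 x.2)),
        (fun i => treeComp (Finsupp.single (b i) (1 : k))
          (fun j => Function.update s x y ⟨i, j⟩)) =
        Function.update (fun i => treeComp (Finsupp.single (b i) (1 : k)) (fun j => s ⟨i, j⟩)) x.1
          (treeComp (Finsupp.single (b x.1) (1 : k))
            (Function.update (fun j => s ⟨x.1, j⟩) x.2 y)) := by
      rintro _ s ⟨i₀, j₀⟩ y
      funext i
      rcases eq_or_ne i i₀ with rfl | hi
      · rw [Function.update_self]
        congr 1
        funext j
        rcases eq_or_ne j j₀ with rfl | hj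
        · simp
        · rw [Function.update_of_ne hj, Function.update_of_ne]
          intro h; exact hj (eq_of_heq (Sigma.mk.inj h).2)
      · rw [Function.update_of_ne hi]
        congr 1
        funext j
        rw [Function.update_of_ne]
        intro h; exact hi (congrArg Sigma.fst h)
    let f₂ : MultilinearMap k (fun x : (Σ i, J i) => TreeMod k Ω (K x.1 x.2))
        (TreeMod k Ω (Σ i, Σ j, K i j)) :=
      { toFun := fun s => treeComp (Finsupp.single t (1 : k))
          (fun i => treeComp (Finsupp.single (b i) (1 : k)) (fun j => s ⟨i, j⟩))
        map_update_add' := by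
          intro _ s x y y'
          simp only [hup, MultilinearMap.map_update_add]
        map_update_smul' := by
          intro _ s x c y
          simp only [hup, MultilinearMap.map_update_smul] }
    have hf : f₁ = f₂ := by
      refine multi_ext k fun d => ?_
      have e1 := treeComp_single (k := k) (t.graft b) d
      have e2 : ∀ i, treeComp (Finsupp.single (b i) (1 : k))
          (fun j => Finsupp.single (d ⟨i, j⟩) (1 : k)) = _ :=
        fun i => treeComp_single (k := k) (b i) (fun j => d ⟨i, j⟩)
      simp only [f₁, f₂, LinearMap.compMultilinearMap_apply, MultilinearMap.coe_mk, e1, e2,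
        treeMap_single, treeComp_single]
      rw [← LTree.graft_assoc t b (fun i j => d ⟨i, j⟩)]
    exact congrArg (fun f => f (fun x => r x.1 x.2)) hf
  exact congrArg (fun f => f q) hq

variable (k Ω)

/-- The operad of formal linear combinations of decorated trees under grafting. -/
def treeOperad : Operad.{v, max u v} k where
  obj X _ := TreeMod k Ω X
  map e := treeMap e
  one := Finsupp.single LTree.triv 1
  comp := treeComp
  map_refl {X} _ p := by
    have h : treeMap (Equiv.refl X) = (LinearMap.id : TreeMod k Ω X →ₗ[k] TreeMod k Ω X) :=
      tree_hom_ext fun t => by simp [treeMap_single, LTree.relabel_refl]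
    exact congrArg (fun f => f p) h
  map_map {X Y Z} _ _ _ e f p := by
    have h : treeMap f ∘ₗ treeMap e = (treeMap (e.trans f) : TreeMod k Ω X →ₗ[k] TreeMod k Ω Z) :=
      tree_hom_ext fun t => by simp [treeMap_single, LTree.relabel_relabel]
    exact congrArg (fun f => f p) h
  map_comp e p q := treeMap_comp e p q
  comp_map {I I'} _ _ e {J} _ p q := by
    have h : ∀ p : TreeMod k Ω I, ∀ q : ∀ i, TreeMod k Ω (J i),
        treeMap (Equiv.sigmaCongrLeft e) (treeComp p (fun i => q (e i))) =
          treeComp (treeMap e p) q := by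
      classical
      intro p q
      induction p using Finsupp.induction_linear with
      | zero => simp
      | add p p' h h' => simp [h, h']
      | single t a =>
      rw [← mul_one a, ← smul_eq_mul, ← Finsupp.smul_single]
      simp only [map_smul, smul_apply]
      congr 1
      let f₁ : MultilinearMap k (fun i => TreeMod k Ω (J i)) (TreeMod k Ω (Σ i, J i)) :=
        { toFun := fun q => treeMap (Equiv.sigmaCongrLeft e)
            (treeComp (Finsupp.single t (1 : k)) (fun i => q (e i)))
          map_update_add' := by
            intro _ q i x y
            obtain ⟨i, rfl⟩ := e.surjective i
            have hu : ∀ z, (fun j => Function.update q (e i) z (e j)) =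
                Function.update (fun j => q (e j)) i z := fun z =>
              Function.update_comp_eq_of_injective' q e.injective i z
            simp only [hu, MultilinearMap.map_update_add, map_add]
          map_update_smul' := by
            intro _ q i c x
            obtain ⟨i, rfl⟩ := e.surjective i
            have hu : ∀ z, (fun j => Function.update q (e i) z (e j)) =
                Function.update (fun j => q (e j)) i z := fun z =>
              Function.update_comp_eq_of_injective' q e.injective i z
            simp only [hu, MultilinearMap.map_update_smul, map_smul] }
      have hf : f₁ = treeComp (treeMap e (Finsupp.single t (1 : k))) := by
        refine multi_ext k fun b => ?_
        have e1 := treeComp_single (k := k) t (fun i => b (e i))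
        simp only [f₁, MultilinearMap.coe_mk, e1, treeMap_single, treeComp_single,
          LTree.graft_relabel]
      exact congrArg (fun f => f q) hf
    exact h p q
  one_comp {X} _ p := by
    have h : ∀ p : TreeMod k Ω X, treeMap (Equiv.uniqueSigma (fun _ : Unit => X))
        (treeComp (Finsupp.single LTree.triv (1 : k)) (fun _ => p)) = p := by
      intro p
      have hc : ∀ q : TreeMod k Ω X, (fun _ : Unit => q) = Function.update (fun _ => 0) () q :=
        fun q => by funext i; simp
      induction p using Finsupp.induction_linear with
      | zero =>
        rw [MultilinearMap.map_coord_zero _ () rfl, map_zero]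
      | add p p' h h' =>
        rw [hc] at h h' ⊢
        rw [MultilinearMap.map_update_add, map_add, h, h']
      | single t a =>
        rw [← mul_one a, ← smul_eq_mul, ← Finsupp.smul_single, hc, MultilinearMap.map_update_smul,
          ← hc, treeComp_single (k := k) LTree.triv (fun _ => t), map_smul, treeMap_single,
          LTree.triv_graft]
    exact h p
  comp_one {X} _ p := by
    have h : treeMap (Equiv.sigmaUnique X (fun _ => Unit)) ∘ₗ
        multiEval k (fun _ => Finsupp.single LTree.triv 1) ∘ₗ treeComp =
        (LinearMap.id : TreeMod k Ω X →ₗ[k] _) := by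
      refine tree_hom_ext fun t => ?_
      have e1 := treeComp_single (k := k) t (fun _ => LTree.triv)
      simp only [LinearMap.comp_apply, multiEval, LinearMap.coe_mk, AddHom.coe_mk, e1,
        treeMap_single, LTree.graft_triv, LinearMap.id_apply]
    exact congrArg (fun f => f p) h
  assoc p q r := treeComp_assoc p q r

end TreeOperad

/-! ### S-modules and free operads -/

/-- An S-module concentrated in arities `n ≥ 1`: a family of representations of the symmetric
groups. The action is written on the left; `σ • ω` stands for the operation
`(x₁, …, xₙ) ↦ ω (x_{σ(1)}, …, x_{σ(n)})`. -/
structure SModule (k : Type v) [CommRing k] where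
  carrier : ℕ+ → Type u
  [instAddCommGroup : ∀ n, AddCommGroup (carrier n)]
  [instModule : ∀ n, Module k (carrier n)]
  act : ∀ n : ℕ+, Representation k (Equiv.Perm (Fin n)) (carrier n)

attribute [instance] SModule.instAddCommGroup SModule.instModule

section Free

variable {k : Type v} [CommRing k] (V : SModule.{u, v} k)

/-- The corolla with vertex `ω`, as an operation of the operad of decorated trees. -/
abbrev corollaOp {n : ℕ+} (ω : V.carrier n) : (treeOperad k V.carrier).obj (Fin n) :=
  Finsupp.single (LTree.corolla n ω) (1 : k)

/-- The identifications of decorated trees: linearity in the decoration of a vertex, and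
`(σ • ω) (x₁, …, xₙ) = ω (x_{σ(1)}, …, x_{σ(n)})`, that is, independence of the chosen order of the
inputs of a vertex. -/
inductive VertexRel : (n : ℕ+) → (treeOperad k V.carrier).obj (Fin n) → Prop
  | add {n : ℕ+} (ω ω' : V.carrier n) :
      VertexRel n (corollaOp V (ω + ω') - corollaOp V ω - corollaOp V ω')
  | smul {n : ℕ+} (a : k) (ω : V.carrier n) :
      VertexRel n (corollaOp V (a • ω) - a • corollaOp V ω)
  | perm {n : ℕ+} (σ : Equiv.Perm (Fin n)) (ω : V.carrier n) :
      VertexRel n (corollaOp V (V.act n σ ω) - (treeOperad k V.carrier).map σ (corollaOp V ω))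

def vertexIdeal : (treeOperad k V.carrier).OpIdeal :=
  Operad.OpIdeal.span (fun n => {x | VertexRel V n x})

/-- The free operad on an S-module: the sum over all (reduced) rooted trees of the tensor products
of the spaces of decorations of the vertices, obtained from the formal combinations of decorated
planar trees by imposing multilinearity in the vertices and independence of the planar structure. -/
def freeOperad : Operad.{v, max u v} k := (vertexIdeal V).quotient

/-- The inclusion of the generators in the free operad. -/
def freeIncl (n : ℕ+) : V.carrier n →ₗ[k] (freeOperad V).obj (Fin n) where
  toFun ω := (vertexIdeal V).cls (corollaOp V ω)
  map_add' ω ω' := by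
    change (vertexIdeal V).cls _ = (vertexIdeal V).cls (corollaOp V ω + corollaOp V ω')
    rw [Submodule.Quotient.eq]
    intro A hA
    have := hA n (VertexRel.add ω ω')
    rwa [sub_sub] at this
  map_smul' a ω := by
    change (vertexIdeal V).cls _ = (vertexIdeal V).cls (a • corollaOp V ω)
    rw [Submodule.Quotient.eq]
    intro A hA
    exact hA n (VertexRel.smul a ω)

/-- Sets of homogeneous relations: `R n` consists of formal linear combinations of decorated trees
all of which have the `n` leaves `1, …, n`. -/
abbrev Relations : Type (max u v) := ∀ n : ℕ+, Set (TreeMod k V.carrier (Fin n))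

/-- The operadic ideal `(R)` of the free operad generated by a set of relations. -/
def relIdeal (R : Relations V) : (freeOperad V).OpIdeal :=
  Operad.OpIdeal.span (fun n => (vertexIdeal V).proj.app (Fin n) '' R n)

/-- The operad `T(V)/(R)`. -/
def presOperad (R : Relations V) : Operad.{v, max u v} k := (relIdeal V R).quotient

/-- The projection `T(V) → T(V)/(R)`. -/
def presProj (R : Relations V) : Operad.Hom (freeOperad V) (presOperad V R) := (relIdeal V R).proj

end Free

/-! ### Configurations and splittings -/

/-- Configurations. The leaves of the trees are numbered from the left to the right. -/
structure Configuration where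
  sets : ∀ n : ℕ+, Set (Finset (Fin n))
  nonempty_of_mem : ∀ {n : ℕ+} {J : Finset (Fin n)}, J ∈ sets n → J.Nonempty
  meet_mem : ∀ {n : ℕ+} {J : Finset (Fin n)}, J ∈ sets n →
    ∀ t : PTree (fun _ => Unit) (Fin n), t.leaves = List.finRange n →
    ∀ (l : ℕ+) (c : Fin l → PTree (fun _ => Unit) (Fin n)), PTree.Subtree (PTree.node l () c) t →
      (PTree.meet J c).Nonempty → PTree.meet J c ∈ sets l

/-- `C.IsIndex m`: the index of `C` exists and is `m`. -/
def Configuration.IsIndex (C : Configuration) (m : ℕ∞) : Prop :=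
  (∃ n : ℕ+, C.sets n = {J | J.Nonempty}) ∧
    IsLUB {x : ℕ∞ | ∃ n : ℕ+, C.sets n = {J | J.Nonempty} ∧ x = ((n : ℕ) : ℕ∞)} m

/-- Configurations that are invariant under the symmetric groups. -/
structure SymConfiguration extends Configuration where
  perm_mem : ∀ {n : ℕ+} (σ : Equiv.Perm (Fin n)) {J : Finset (Fin n)}, J ∈ sets n →
    J.map σ.toEmbedding ∈ sets n

/-- The configuration of all one-element sets. -/
def arityConfig : SymConfiguration where
  sets n := {J | ∃ i, J = {i}}
  nonempty_of_mem := by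
    rintro n _ ⟨i, rfl⟩
    exact Finset.singleton_nonempty i
  meet_mem := by
    rintro n _ ⟨x, rfl⟩ t ht l c hs ⟨i, hi⟩
    refine ⟨i, Finset.eq_singleton_iff_unique_mem.2 ⟨hi, fun j hj => ?_⟩⟩
    have hnd := hs.nodup (ht ▸ List.nodup_finRange n)
    simp only [PTree.meet, Finset.mem_filter, Finset.mem_univ, true_and, Finset.mem_singleton,
      exists_eq_right] at hi hj
    rw [PTree.leaves, List.nodup_flatMap] at hnd
    by_contra hne
    have hp : (List.finRange (l : ℕ)).Pairwise
        (fun i j => List.Disjoint (c i).leaves (c j).leaves) := hnd.2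
    have : Std.Symm (fun i j : Fin l => List.Disjoint (c i).leaves (c j).leaves) :=
      ⟨fun _ _ h => h.symm⟩
    exact hp.forall (List.mem_finRange j) (List.mem_finRange i) hne hj hi
  perm_mem := by
    rintro n σ _ ⟨i, rfl⟩
    exact ⟨σ i, by simp⟩

section Splitting

variable {k : Type v} [CommRing k] (C : SymConfiguration) (V : SModule.{u, v} k)

/-- The permutation representation on `⨁ I ∈ C n, k e_I`, with `σ • e_I = e_{σ(I)}`. -/
def permRep (n : ℕ+) : Representation k (Equiv.Perm (Fin n)) (C.sets n →₀ k) where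
  toFun σ := Finsupp.lmapDomain k k
    (fun I : C.sets n => (⟨I.1.map σ.toEmbedding, C.perm_mem σ I.2⟩ : C.sets n))
  map_one' := by
    ext I : 1
    refine LinearMap.ext_ring ?_
    have h : (⟨I.1.map (Equiv.toEmbedding 1), C.perm_mem 1 I.2⟩ : C.sets n) = I :=
      Subtype.ext (by ext; simp; rfl)
    simp [h]
  map_mul' σ τ := by
    ext I : 1
    refine LinearMap.ext_ring ?_
    simp [Finset.map_map]
    rfl

/-- The S-module `CSp(V)`, with `CSp(V)(n) = V(n) ⊗ ⨁ I ∈ C n, k e_I` and the diagonal action. -/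
def splitModule : SModule.{max u v, v} k where
  carrier n := TensorProduct k (V.carrier n) (C.sets n →₀ k)
  act n := (V.act n).tprod (permRep C n)

open Classical in
/-- The linear map `ω ↦ (ω, e_I)`, which is `0` by convention if `I` is not in `C n`. -/
def splitVec {n : ℕ+} (I : Finset (Fin n)) : V.carrier n →ₗ[k] (splitModule C V).carrier n :=
  if h : I ∈ C.sets n then
    (TensorProduct.mk k (V.carrier n) (C.sets n →₀ k)).flip (Finsupp.single ⟨I, h⟩ 1)
  else 0

open Classical in
/-- The linear map `ω ↦ (ω, *)`, with `(ω, *)` the sum of all `(ω, e_I)` for `I ∈ C n`. -/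
def splitStar {n : ℕ+} : V.carrier n →ₗ[k] (splitModule C V).carrier n :=
  ∑ I ∈ Finset.univ.filter (fun I : Finset (Fin n) => I ∈ C.sets n), splitVec C V I

/-- The decorated tree `CSp(t)`: each decoration `ω` is replaced by `(ω, *)`. -/
def starTree {X : Type} : PTree V.carrier X → PTree (splitModule C V).carrier X
  | .leaf x => .leaf x
  | .node n ω c => .node n (splitStar C V ω) (fun i => starTree (c i))

open Classical in
/-- The splitting `CSp_J(t)` of a decorated tree `t = ω (t₁ ∨ ⋯ ∨ tₙ)` at a nonempty set `J` of
labels: the root is decorated by `(ω, e_I)` with `I = J ⊓ ω`, and the branch `tᵢ` is split at the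
set of those of its labels that are in `J`, or replaced by `CSp(tᵢ)` if there are none. -/
def splitTree {X : Type} (J : Finset X) : PTree V.carrier X → PTree (splitModule C V).carrier X
  | .leaf x => .leaf x
  | .node n ω c => .node n (splitVec C V (PTree.meet J c) ω)
      (fun i => if i ∈ PTree.meet J c then splitTree J (c i) else starTree C V (c i))

theorem leaves_starTree {X : Type} (t : PTree V.carrier X) :
    (starTree C V t).leaves = t.leaves := by
  induction t with
  | leaf x => rfl
  | node n v c ih => simp only [starTree, PTree.leaves, ih]

theorem leaves_splitTree {X : Type} (J : Finset X) (t : PTree V.carrier X) :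
    (splitTree C V J t).leaves = t.leaves := by
  induction t with
  | leaf x => rfl
  | node n v c ih =>
    simp only [splitTree, PTree.leaves]
    congr 1
    funext i
    split
    · exact ih i
    · exact leaves_starTree C V (c i)

/-- The linear extension `∑ cᵢ τᵢ ↦ ∑ cᵢ CSp_J(τᵢ)`. -/
def splitLin {X : Type} (J : Finset X) :
    TreeMod k V.carrier X →ₗ[k] TreeMod k (splitModule C V).carrier X :=
  Finsupp.lmapDomain k k (fun t =>
    ⟨splitTree C V J t.1, by
      have h := t.2
      rwa [PTree.Labelled, ← leaves_splitTree C V J t.1] at h⟩)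

/-- The split relations `CSp_J(r)` for `r ∈ R n` and `J ∈ C n`. -/
def splitRel (R : Relations V) : Relations (splitModule C V) :=
  fun n => {s | ∃ r ∈ R n, ∃ J ∈ C.sets n, s = splitLin C V J r}

/-- The `C`-splitting `CSp(P)` of the operad `P = T(V)/(R)`. -/
def splitOperad (R : Relations V) : Operad.{v, max u v} k :=
  presOperad (splitModule C V) (splitRel C V R)

/-- A morphism `φ` from `P = T(V)/(R)` to `CSp(P)` is induced by a family of linear maps
`f : V(n) → CSp(V)(n)` if it restricts to `f` on generators. -/
def InducedBy (R : Relations V) (φ : Operad.Hom (presOperad V R) (splitOperad C V R))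
    (f : ∀ n : ℕ+, V.carrier n →ₗ[k] (splitModule C V).carrier n) : Prop :=
  ∀ (n : ℕ+) (ω : V.carrier n),
    φ.app (Fin n) ((presProj V R).app (Fin n) (freeIncl V n ω)) =
      (presProj (splitModule C V) (splitRel C V R)).app (Fin n)
        (freeIncl (splitModule C V) n (f n ω))

end Splitting

end

/-! A morphism out of a presented operad is determined by its values on generators, which gives
uniqueness. For existence, an equivariant linear map of generators is extended to decorated trees by
redecorating vertices. It then suffices that each relation `r` goes into the ideal generated by the
split relations (`exists_presOperad_hom`). Equivariance holds because a permutation only permutes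
the sets `I` in the configuration.

For the map `ω ↦ (ω, *)` the key is an identity in the free operad on `CSp(V)`: the class of
`CSp(t)` is the sum of the classes of `CSp_J(t)` over all nonempty sets `J` of leaves
(`treeClass_star`). Expanding every `(ω, *)` by multilinearity chooses a set of inputs at each
vertex. A branch over an unchosen input keeps its stars, and the expansion proceeds along the chosen
ones until a set `J` of leaves has been selected. Hence `r` is sent to the sum of all `CSp_J(r)`. If
the arity of `r` is at most the index, every nonempty `J` belongs to the configuration and each
summand is a relation. For the arity configuration the summands with `J` a singleton are relations.
The others are zero already in the free operad: the paths from the root to two leaves of `J` part at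
some vertex `ω`, where `J ⊓ ω` has at least two elements (`treeClass_split_arityConfig`).

For `ω ↦ (ω, e_[n])`, every branch has a leaf, so `[n] ⊓ ω` is the set of all inputs of `ω`. The
redecorated tree therefore equals `CSp_[n](t)`, and `[n]` belongs to the configuration below the
index.

That arities up to the index have all nonempty sets is not part of the definition of a supremum. It
follows from `Configuration.sets_eq_of_le`, which passes from `n` to any `l ≤ n` by one well-chosen
tree. -/

noncomputable section

/-! ### Morphisms of operads, kernels and maps out of quotients -/

namespace Operad

variable {k : Type v} [CommRing k]

/-- The composite of two morphisms of operads. -/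
def Hom.trans {P Q T : Operad k} (φ : Hom P Q) (ψ : Hom Q T) : Hom P T where
  app X _ := ψ.app X ∘ₗ φ.app X
  app_map e p := by simp [φ.app_map, ψ.app_map]
  app_one := by simp [φ.app_one, ψ.app_one]
  app_comp p q := by simp [φ.app_comp, ψ.app_comp]

namespace OpIdeal

variable {P Q : Operad k}

/-- The kernel of a morphism of operads. -/
def kernel (φ : Hom P Q) : OpIdeal P where
  sub X _ := LinearMap.ker (φ.app X)
  map_mem e p hp := by
    rw [LinearMap.mem_ker] at hp ⊢
    rw [φ.app_map, hp, map_zero]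
  comp_mem_left p q hp := by
    rw [LinearMap.mem_ker] at hp ⊢
    rw [φ.app_comp, hp, map_zero, zero_apply]
  comp_mem_right p q i hq := by
    rw [LinearMap.mem_ker] at hq ⊢
    rw [φ.app_comp]
    exact MultilinearMap.map_coord_zero _ i hq

theorem mem_kernel {φ : Hom P Q} {X : Type} [Finite X] {p : P.obj X} :
    p ∈ (kernel φ).sub X ↔ φ.app X p = 0 := Iff.rfl

theorem span_le {S : ∀ n : ℕ+, Set (P.obj (Fin n))} {A : OpIdeal P}
    (h : ∀ n, S n ⊆ A.sub (Fin n)) (X : Type) [Finite X] : (span S).sub X ≤ A.sub X :=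
  fun _ hp => hp A h

theorem subset_span (S : ∀ n : ℕ+, Set (P.obj (Fin n))) (n : ℕ+) :
    S n ⊆ (span S).sub (Fin n) :=
  fun _ hp _ hA => hA n hp

/-- The morphism induced on the quotient by a morphism that vanishes on the ideal. -/
def lift (A : OpIdeal P) (φ : Hom P Q)
    (h : ∀ (X : Type) [Finite X], A.sub X ≤ (kernel φ).sub X) : Hom A.quotient Q where
  app X _ := (A.sub X).liftQ (φ.app X) (h X)
  app_map e p := by
    obtain ⟨p, rfl⟩ := Submodule.Quotient.mk_surjective _ p
    exact φ.app_map e p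
  app_one := φ.app_one
  app_comp p q := by
    obtain ⟨p, rfl⟩ := Submodule.Quotient.mk_surjective _ p
    obtain ⟨q, rfl⟩ := A.exists_cls q
    refine Eq.trans ?_ (φ.app_comp p q)
    exact congrArg ((A.sub _).liftQ (φ.app _) (h _)) (A.quoComp_cls p q)

theorem proj_eq_zero {A : OpIdeal P} {X : Type} [Finite X] {p : P.obj X} :
    A.proj.app X p = 0 ↔ p ∈ A.sub X :=
  Submodule.Quotient.mk_eq_zero (A.sub X)

theorem quotient_hom_ext {A : OpIdeal P} {φ ψ : Hom A.quotient Q}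
    (h : A.proj.trans φ = A.proj.trans ψ) : φ = ψ := by
  ext X _ p
  obtain ⟨p, rfl⟩ := Submodule.Quotient.mk_surjective _ p
  exact congrArg (fun χ : Hom P Q => χ.app X p) h

end OpIdeal

end Operad

/-! ### Redecoration of trees, and induction over labelled trees -/

namespace PTree

variable {Ω : ℕ+ → Type u} {Ω' : ℕ+ → Type w} {X Y : Type}

/-- Replacement of the decorations of the vertices. -/
def mapDeco (g : ∀ n, Ω n → Ω' n) : PTree Ω X → PTree Ω' X
  | leaf x => leaf x
  | node n v c => node n (g n v) (fun i => (c i).mapDeco g)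

theorem leaves_mapDeco (g : ∀ n, Ω n → Ω' n) (t : PTree Ω X) :
    (t.mapDeco g).leaves = t.leaves := by
  induction t with
  | leaf x => rfl
  | node n v c ih => simp only [mapDeco, leaves, ih]

theorem mapDeco_bind (g : ∀ n, Ω n → Ω' n) (t : PTree Ω X) (f : X → PTree Ω Y) :
    (t.bind f).mapDeco g = (t.mapDeco g).bind (fun x => (f x).mapDeco g) := by
  induction t with
  | leaf x => rfl
  | node n v c ih => simp only [bind, mapDeco, ih]

theorem mapDeco_relabel (g : ∀ n, Ω n → Ω' n) (t : PTree Ω X) (f : X → Y) :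
    (t.relabel f).mapDeco g = (t.mapDeco g).relabel f :=
  mapDeco_bind g t _

/-- Arities are positive, so input `0` always exists and one can climb to a leaf. -/
theorem exists_mem_leaves (t : PTree Ω X) : ∃ x, x ∈ t.leaves := by
  induction t with
  | leaf x => exact ⟨x, by simp [leaves]⟩
  | node n v c ih =>
    obtain ⟨x, hx⟩ := ih ⟨0, n.pos⟩
    exact ⟨x, List.mem_flatMap.2 ⟨_, List.mem_finRange _, hx⟩⟩

theorem mem_meet {J : Finset X} {n : ℕ+} {c : Fin n → PTree Ω X} {i : Fin n} :
    i ∈ meet J c ↔ ∃ x ∈ (c i).leaves, x ∈ J := by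
  simp [meet]

theorem leaves_node_nodup {n : ℕ+} {v : Ω n} {c : Fin n → PTree Ω X}
    (h : (node n v c).leaves.Nodup) :
    (∀ i, (c i).leaves.Nodup) ∧
      ∀ i j x, x ∈ (c i).leaves → x ∈ (c j).leaves → i = j := by
  rw [leaves, List.nodup_flatMap] at h
  refine ⟨fun i => h.1 i (List.mem_finRange i), fun i j x hi hj => ?_⟩
  by_contra hne
  have : Std.Symm (fun i j : Fin n => List.Disjoint (c i).leaves (c j).leaves) :=
    ⟨fun _ _ h => h.symm⟩
  have hp : (List.finRange (n : ℕ)).Pairwise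
      (fun i j => List.Disjoint (c i).leaves (c j).leaves) := h.2
  exact hp.forall (List.mem_finRange i) (List.mem_finRange j) hne hi hj

end PTree

namespace LTree

variable {Ω : ℕ+ → Type u} {Ω' : ℕ+ → Type w}

def mapDeco {X : Type} (g : ∀ n, Ω n → Ω' n) (t : LTree Ω X) : LTree Ω' X :=
  ⟨t.1.mapDeco g, by
    have h := t.2
    rwa [PTree.Labelled, ← PTree.leaves_mapDeco g t.1] at h⟩

theorem mapDeco_relabel {X Y : Type} (g : ∀ n, Ω n → Ω' n) (e : X ≃ Y) (t : LTree Ω X) :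
    (t.relabel e).mapDeco g = (t.mapDeco g).relabel e :=
  Subtype.ext (PTree.mapDeco_relabel g t.1 e)

theorem mapDeco_graft {I : Type} {J : I → Type} (g : ∀ n, Ω n → Ω' n) (t : LTree Ω I)
    (b : ∀ i, LTree Ω (J i)) :
    (t.graft b).mapDeco g = (t.mapDeco g).graft (fun i => (b i).mapDeco g) :=
  Subtype.ext (by
    simp only [mapDeco, graft, PTree.graft, PTree.mapDeco_bind, PTree.mapDeco_relabel])

/-- Trees are built from the trivial tree by relabelling and by grafting on corollas. -/
theorem induction {motive : ∀ (X : Type) [Finite X], LTree Ω X → Prop}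
    (triv : motive Unit triv)
    (relabel : ∀ {X Y : Type} [Finite X] [Finite Y] (e : X ≃ Y) (t : LTree Ω X),
      motive X t → motive Y (t.relabel e))
    (graft : ∀ (n : ℕ+) (v : Ω n) {J : Fin n → Type} [∀ i, Finite (J i)]
      (b : ∀ i, LTree Ω (J i)), (∀ i, motive (J i) (b i)) →
      motive (Σ i, J i) ((corolla n v).graft b))
    {X : Type} [Finite X] (t : LTree Ω X) : motive X t := by
  -- A branch of a tree labelled by `X` uses only some of the labels, so structural recursion leaves
  -- the bijectively labelled trees. The statement is therefore generalised to trees with distinct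
  -- leaves, viewed as relabellings along an injection of a tree labelled bijectively by a smaller
  -- set.
  have key : ∀ s : PTree Ω X, s.leaves.Nodup → ∃ (Y : Type) (_ : Finite Y) (s' : LTree Ω Y)
      (f : Y → X), Function.Injective f ∧ s'.1.relabel f = s ∧ motive Y s' := by
    intro s
    induction s with
    | leaf x =>
      intro _
      exact ⟨Unit, inferInstance, _, fun _ => x, fun _ _ _ => rfl, rfl, triv⟩
    | node n v c ih =>
      intro h
      obtain ⟨h1, h2⟩ := PTree.leaves_node_nodup h
      choose Y hY s f hf hs hm using fun i => ih i (h1 i)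
      refine ⟨Σ i, Y i, inferInstance, (corolla n v).graft s, fun x => f x.1 x.2, ?_, ?_,
        graft n v s hm⟩
      · have hmem : ∀ i y, f i y ∈ (c i).leaves := by
          intro i y
          rw [← hs i, PTree.leaves_relabel]
          exact List.mem_map_of_mem ((s i).2.2 y)
        rintro ⟨i, y⟩ ⟨j, z⟩ (hyz : f i y = f j z)
        obtain rfl := h2 i j _ (hmem i y) (hyz ▸ hmem j z)
        rw [hf i hyz]
      · simp only [LTree.graft, corolla, PTree.corolla, PTree.graft, PTree.relabel,
          PTree.bind_bind, PTree.bind]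
        congr 1
        funext i
        exact hs i
  obtain ⟨Y, _, s, f, hf, hs, hm⟩ := key t.1 t.2.1
  -- For `t` itself every label occurs, which turns the injection into a bijection.
  have hsurj : Function.Surjective f := by
    intro x
    have := t.2.2 x
    rw [← hs, PTree.leaves_relabel, List.mem_map] at this
    obtain ⟨y, _, hy⟩ := this
    exact ⟨y, hy⟩
  have ht : t = s.relabel (Equiv.ofBijective f ⟨hf, hsurj⟩) := Subtype.ext hs.symm
  rw [ht]
  exact relabel _ _ hm

end LTree

/-! ### Morphisms out of the operad of decorated trees -/

section TreeOperad

variable {k : Type v} [CommRing k] {Ω : ℕ+ → Type u} {Ω' : ℕ+ → Type w}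

variable (k) in
/-- A decorated tree, as an operation of the operad of decorated trees. -/
def treeOp {X : Type} [Finite X] (t : LTree Ω X) : (treeOperad k Ω).obj X :=
  Finsupp.single t (1 : k)

theorem map_treeOp {X Y : Type} [Finite X] [Finite Y] (e : X ≃ Y) (t : LTree Ω X) :
    (treeOperad k Ω).map e (treeOp k t) = treeOp k (t.relabel e) :=
  treeMap_single e t 1

theorem comp_treeOp {I : Type} [Finite I] {J : I → Type} [∀ i, Finite (J i)]
    (t : LTree Ω I) (b : ∀ i, LTree Ω (J i)) :
    (treeOperad k Ω).comp (treeOp k t) (fun i => treeOp k (b i)) = treeOp k (t.graft b) :=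
  treeComp_single t b

theorem treeOperad_linear_ext {X : Type} [Finite X] {N : Type w'} [AddCommGroup N] [Module k N]
    {f g : (treeOperad k Ω).obj X →ₗ[k] N} (h : ∀ t, f (treeOp k t) = g (treeOp k t)) : f = g :=
  tree_hom_ext h

variable (k) in
/-- The morphism of operads of trees given by replacing the decorations. -/
def decorate (g : ∀ n, Ω n → Ω' n) : Operad.Hom (treeOperad k Ω) (treeOperad k Ω') where
  app X _ := Finsupp.lmapDomain k k (LTree.mapDeco g)
  app_map {X Y} _ _ e p := by
    have h : Finsupp.lmapDomain k k (LTree.mapDeco g) ∘ₗ treeMap e =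
        treeMap e ∘ₗ (Finsupp.lmapDomain k k (LTree.mapDeco g) : TreeMod k Ω X →ₗ[k] _) :=
      tree_hom_ext fun t => by simp [treeMap_single, LTree.mapDeco_relabel]
    exact congrArg (fun f => f p) h
  app_one := by
    refine (Finsupp.mapDomain_single).trans ?_
    rfl
  app_comp {I} _ {J} _ p q := by
    -- Both sides are packaged as linear in `p` with multilinear values in `q`, so that they may be
    -- compared on single trees.
    have h : (Finsupp.lmapDomain k k (LTree.mapDeco g)).compMultilinearMapₗ k ∘ₗ
        treeComp (k := k) (Ω := Ω) (I := I) (J := J) =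
        MultilinearMap.compLinearMapₗ (fun i => Finsupp.lmapDomain k k (LTree.mapDeco g)) ∘ₗ
          treeComp ∘ₗ Finsupp.lmapDomain k k (LTree.mapDeco g) := by
      refine tree_hom_ext fun t => multi_ext k fun b => ?_
      simp [treeComp_single, LTree.mapDeco_graft]
    exact congrArg (fun f => f p q) h

theorem decorate_treeOp (g : ∀ n, Ω n → Ω' n) {X : Type} [Finite X] (t : LTree Ω X) :
    (decorate k g).app X (treeOp k t) = treeOp k (t.mapDeco g) :=
  Finsupp.mapDomain_single

/-- A morphism from the operad of decorated trees is determined by its values on corollas. -/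
theorem treeOperad_hom_ext {Q : Operad.{v, w'} k} {φ ψ : Operad.Hom (treeOperad k Ω) Q}
    (h : ∀ (n : ℕ+) (v : Ω n), φ.app (Fin n) (treeOp k (LTree.corolla n v)) =
      ψ.app (Fin n) (treeOp k (LTree.corolla n v))) : φ = ψ := by
  refine Operad.Hom.ext ?_
  funext X _
  refine treeOperad_linear_ext fun t => ?_
  refine LTree.induction (motive := fun X _ t => φ.app X (treeOp k t) = ψ.app X (treeOp k t))
    ?_ ?_ ?_ t
  · exact φ.app_one.trans ψ.app_one.symm
  · intro X Y _ _ e t ih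
    rw [← map_treeOp, φ.app_map, ψ.app_map, ih]
  · intro n v J _ b ih
    rw [← comp_treeOp, φ.app_comp, ψ.app_comp, h]
    simp only [ih]

end TreeOperad

/-! ### Universal property of operads given by generators and relations -/

section Presentation

variable {k : Type v} [CommRing k] {V : SModule.{u, v} k} {W : SModule.{w, v} k}

variable (V) in
/-- The projection of the operad of decorated trees to the free operad. -/
def freeProj : Operad.Hom (treeOperad k V.carrier) (freeOperad V) := (vertexIdeal V).proj

/-- The relations, as operations of the operad of decorated trees. -/
def relOps (R : Relations V) (n : ℕ+) : Set ((treeOperad k V.carrier).obj (Fin n)) := R n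

theorem freeIncl_act {n : ℕ+} (σ : Equiv.Perm (Fin n)) (ω : V.carrier n) :
    freeIncl V n (V.act n σ ω) = (freeOperad V).map σ (freeIncl V n ω) := by
  change (vertexIdeal V).cls _ = (vertexIdeal V).cls ((treeOperad k V.carrier).map σ _)
  rw [Submodule.Quotient.eq]
  exact Operad.OpIdeal.subset_span _ n (VertexRel.perm σ ω)

/-- A morphism from an operad with given generators and relations is determined by its values on
the generators. -/
theorem presOperad_hom_ext {R : Relations V} {Q : Operad.{v, w'} k}
    {φ ψ : Operad.Hom (presOperad V R) Q}
    (h : ∀ (n : ℕ+) (ω : V.carrier n),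
      φ.app (Fin n) ((presProj V R).app (Fin n) (freeIncl V n ω)) =
        ψ.app (Fin n) ((presProj V R).app (Fin n) (freeIncl V n ω))) : φ = ψ :=
  Operad.OpIdeal.quotient_hom_ext <| Operad.OpIdeal.quotient_hom_ext <|
    treeOperad_hom_ext fun n v => h n v

/-- Equivariant maps of generators which send the relations to consequences of relations induce a
morphism of the operads. -/
theorem exists_presOperad_hom (R : Relations V) (S : Relations W)
    (f : ∀ n : ℕ+, V.carrier n →ₗ[k] W.carrier n)
    (hf : ∀ (n : ℕ+) (σ : Equiv.Perm (Fin n)) (ω : V.carrier n),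
      f n (V.act n σ ω) = W.act n σ (f n ω))
    (hR : ∀ (n : ℕ+), ∀ r ∈ relOps R n, (freeProj W).app (Fin n)
      ((decorate k (fun n => f n)).app (Fin n) r) ∈ (relIdeal W S).sub (Fin n)) :
    ∃ φ : Operad.Hom (presOperad V R) (presOperad W S), ∀ (n : ℕ+) (ω : V.carrier n),
      φ.app (Fin n) ((presProj V R).app (Fin n) (freeIncl V n ω)) =
        (presProj W S).app (Fin n) (freeIncl W n (f n ω)) := by
  let φ₀ : Operad.Hom (treeOperad k V.carrier) (freeOperad W) :=
    (decorate k (fun n => f n)).trans (freeProj W)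
  have hφ₀ : ∀ (n : ℕ+) (ω : V.carrier n),
      φ₀.app (Fin n) (corollaOp V ω) = freeIncl W n (f n ω) := fun n ω =>
    congrArg ((freeProj W).app (Fin n)) (decorate_treeOp _ (LTree.corolla n ω))
  -- Descent to the free operad: the vertex relations die by linearity of `f n` and by its
  -- equivariance `hf`.
  have h₀ : ∀ (X : Type) [Finite X],
      (vertexIdeal V).sub X ≤ (Operad.OpIdeal.kernel φ₀).sub X := by
    refine Operad.OpIdeal.span_le fun n x hx => ?_
    refine Operad.OpIdeal.mem_kernel.2 ?_
    cases hx with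
    | add ω ω' => rw [map_sub, map_sub, hφ₀, hφ₀, hφ₀, map_add, map_add]; abel
    | smul a ω => rw [map_sub, map_smul, hφ₀, hφ₀, map_smul, map_smul, sub_self]
    | perm σ ω => rw [map_sub, φ₀.app_map, hφ₀, hφ₀, hf, freeIncl_act, sub_self]
  let φ₁ : Operad.Hom (freeOperad V) (presOperad W S) :=
    ((vertexIdeal V).lift φ₀ h₀).trans (presProj W S)
  -- Descent to the quotient by `R`, which is exactly what `hR` provides.
  have h₁ : ∀ (X : Type) [Finite X],
      (relIdeal V R).sub X ≤ (Operad.OpIdeal.kernel φ₁).sub X := by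
    refine Operad.OpIdeal.span_le fun n x hx => ?_
    obtain ⟨r, hr, rfl⟩ := hx
    exact Operad.OpIdeal.mem_kernel.2 (Operad.OpIdeal.proj_eq_zero.2 (hR n r hr))
  refine ⟨(relIdeal V R).lift φ₁ h₁, fun n ω => ?_⟩
  exact congrArg ((presProj W S).app (Fin n)) (hφ₀ n ω)

end Presentation

section TreeClass

variable {k : Type v} [CommRing k] (W : SModule.{u, v} k)

/-- The class of a decorated tree in the free operad. -/
def treeClass {X : Type} [Finite X] (t : LTree W.carrier X) : (freeOperad W).obj X :=
  (freeProj W).app X (treeOp k t)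

theorem treeClass_relabel {X Y : Type} [Finite X] [Finite Y] (e : X ≃ Y)
    (t : LTree W.carrier X) :
    treeClass W (t.relabel e) = (freeOperad W).map e (treeClass W t) := by
  rw [treeClass, ← map_treeOp]
  exact (freeProj W).app_map e _

theorem treeClass_graft {n : ℕ+} (v : W.carrier n) {J : Fin n → Type} [∀ i, Finite (J i)]
    (b : ∀ i, LTree W.carrier (J i)) :
    treeClass W ((LTree.corolla n v).graft b) =
      (freeOperad W).comp (freeIncl W n v) (fun i => treeClass W (b i)) := by
  rw [treeClass, ← comp_treeOp]
  exact (freeProj W).app_comp _ _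

end TreeClass

/-! ### Equivariance of the splitting maps on generators -/

section Splitting

variable {k : Type v} [CommRing k] (C : SymConfiguration) (V : SModule.{u, v} k)

theorem mem_sets_map_iff {n : ℕ+} (σ : Equiv.Perm (Fin n)) {I : Finset (Fin n)} :
    I.map σ.toEmbedding ∈ C.sets n ↔ I ∈ C.sets n := by
  refine ⟨fun h => ?_, C.perm_mem σ⟩
  have := C.perm_mem σ.symm h
  rw [Finset.map_map] at this
  convert this
  ext; simp

theorem splitVec_of_mem {n : ℕ+} {I : Finset (Fin n)} (h : I ∈ C.sets n) (ω : V.carrier n) :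
    splitVec C V I ω = TensorProduct.tmul k ω (Finsupp.single ⟨I, h⟩ (1 : k)) :=
  DFunLike.congr_fun (dif_pos h : splitVec C V I = _) ω

theorem splitVec_of_notMem {n : ℕ+} {I : Finset (Fin n)} (h : I ∉ C.sets n) :
    splitVec C V I = 0 :=
  dif_neg h

/-- Invariance of the configuration makes the convention `(ω, e_I) = 0` compatible with the action:
`I` and its image lie outside `C.sets n` simultaneously. -/
theorem splitVec_act {n : ℕ+} (σ : Equiv.Perm (Fin n)) (I : Finset (Fin n)) (ω : V.carrier n) :
    splitVec C V (I.map σ.toEmbedding) (V.act n σ ω) =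
      (splitModule C V).act n σ (splitVec C V I ω) := by
  by_cases h : I ∈ C.sets n
  · rw [splitVec_of_mem C V h, splitVec_of_mem C V (C.perm_mem σ h)]
    refine Eq.trans ?_ (TensorProduct.map_tmul (V.act n σ) (permRep C n σ) ω _).symm
    have hI : permRep C n σ (Finsupp.single ⟨I, h⟩ (1 : k)) =
        Finsupp.single ⟨I.map σ.toEmbedding, C.perm_mem σ h⟩ (1 : k) := Finsupp.mapDomain_single
    exact congrArg (TensorProduct.tmul k _) hI.symm
  · rw [splitVec_of_notMem C V h, splitVec_of_notMem C V (mt (mem_sets_map_iff C σ).1 h)]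
    simp

/-- With the zero convention the index set need not mention `C`, which makes reindexing by
permutations and summation over fibres possible. -/
theorem splitStar_eq_sum {n : ℕ+} :
    splitStar C V = ∑ I : Finset (Fin n), splitVec C V I := by
  classical
  rw [splitStar]
  refine Finset.sum_subset (Finset.filter_subset _ _) fun I _ hI => ?_
  exact splitVec_of_notMem C V (by simpa using hI)

theorem splitStar_act {n : ℕ+} (σ : Equiv.Perm (Fin n)) (ω : V.carrier n) :
    splitStar C V (V.act n σ ω) = (splitModule C V).act n σ (splitStar C V ω) := by
  simp only [splitStar_eq_sum, LinearMap.sum_apply, map_sum]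
  refine (Fintype.sum_equiv (Equiv.finsetCongr σ) _ _ fun I => ?_).symm
  exact (splitVec_act C V σ I ω).symm

theorem splitStar_eq_sum_nonempty {n : ℕ+} :
    splitStar C V =
      ∑ I ∈ Finset.univ.filter (fun I : Finset (Fin n) => I.Nonempty), splitVec C V I := by
  rw [splitStar_eq_sum]
  refine (Finset.sum_subset (Finset.filter_subset _ _) fun I _ hI => ?_).symm
  refine splitVec_of_notMem C V fun h => hI ?_
  simpa using C.nonempty_of_mem h

/-- Together with `splitStar_eq_sum_nonempty`, this lets the first two maps of the theorem be
treated as the single map `splitStar`. -/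
theorem splitStar_arityConfig {n : ℕ+} :
    splitStar arityConfig V = ∑ i : Fin n, splitVec arityConfig V ({i} : Finset (Fin n)) := by
  classical
  rw [splitStar_eq_sum, ← Finset.sum_image (s := Finset.univ) (g := fun i : Fin n => {i})
    (f := splitVec arityConfig V) (Finset.singleton_injective.injOn)]
  refine (Finset.sum_subset (Finset.subset_univ _) fun I _ hI => ?_).symm
  refine splitVec_of_notMem _ V ?_
  rintro ⟨i, rfl⟩
  exact hI (Finset.mem_image_of_mem _ (Finset.mem_univ i))

theorem starTree_eq_mapDeco {X : Type} (t : PTree V.carrier X) :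
    starTree C V t = t.mapDeco (fun _ => splitStar C V) := by
  induction t with
  | leaf x => rfl
  | node n v c ih => simp only [starTree, PTree.mapDeco, ih]

/-- `J'` may be larger than the image of `J`. This covers the inclusion of one summand `J i` into a
disjoint union, besides bijections. -/
theorem splitTree_relabel {X Y : Type} (f : X → Y) {J : Finset X} {J' : Finset Y}
    (hJ : ∀ x, f x ∈ J' ↔ x ∈ J) (t : PTree V.carrier X) :
    splitTree C V J' (t.relabel f) = (splitTree C V J t).relabel f := by
  classical
  induction t with
  | leaf x => rfl
  | node n v c ih =>
    have hm : PTree.meet J' (fun i => (c i).relabel f) = PTree.meet J c := by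
      ext i
      simp only [PTree.mem_meet, PTree.leaves_relabel, List.mem_map]
      constructor
      · rintro ⟨_, ⟨x, hx, rfl⟩, h⟩
        exact ⟨x, hx, (hJ x).1 h⟩
      · rintro ⟨x, hx, h⟩
        exact ⟨f x, ⟨x, hx, rfl⟩, (hJ x).2 h⟩
    change splitTree C V J' (.node n v (fun i => (c i).relabel f)) =
      .node n _ (fun i => (ite _ _ _ : PTree _ _).relabel f)
    rw [splitTree, hm]
    congr 1
    funext i
    by_cases hi : i ∈ PTree.meet J c
    · rw [if_pos hi, if_pos hi, ih i]
    · rw [if_neg hi, if_neg hi, starTree_eq_mapDeco, starTree_eq_mapDeco, PTree.mapDeco_relabel]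

/-- Every branch has a leaf, so every meet is full and the starred alternative never occurs. -/
theorem splitTree_univ {X : Type} [Fintype X] (t : PTree V.carrier X) :
    splitTree C V Finset.univ t = t.mapDeco (fun _ => splitVec C V Finset.univ) := by
  induction t with
  | leaf x => rfl
  | node n v c ih =>
    have hm : PTree.meet Finset.univ c = Finset.univ := by
      ext i
      simpa [PTree.mem_meet] using (c i).exists_mem_leaves
    simp only [splitTree, PTree.mapDeco, hm, Finset.mem_univ, if_true, ih]

/-! ### Splitting of a tree grafted on a corolla -/

namespace LTree

/-- The labelled tree `CSp(t)`. -/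
def star {X : Type} (t : LTree V.carrier X) : LTree (splitModule C V).carrier X :=
  t.mapDeco (fun _ => splitStar C V)

/-- The labelled tree `CSp_J(t)`. -/
def split {X : Type} (J : Finset X) (t : LTree V.carrier X) :
    LTree (splitModule C V).carrier X :=
  ⟨splitTree C V J t.1, by
    have h := t.2
    rwa [PTree.Labelled, ← leaves_splitTree C V J t.1] at h⟩

theorem split_relabel {X Y : Type} (e : X ≃ Y) (J : Finset X) (t : LTree V.carrier X) :
    (t.relabel e).split C V (J.map e.toEmbedding) = (t.split C V J).relabel e :=
  Subtype.ext (splitTree_relabel C V e (by simp) t.1)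

open Classical in
/-- The splitting of a branch: `CSp_J(t)` if `J` is nonempty and `CSp(t)` otherwise. -/
def branch {X : Type} (J : Finset X) (t : LTree V.carrier X) :
    LTree (splitModule C V).carrier X :=
  if J.Nonempty then t.split C V J else t.star C V

/-- The set of those inputs of a corolla above which there is an element of the set. -/
def support {n : ℕ+} {J : Fin n → Type} (K : ∀ i, Finset (J i)) : Finset (Fin n) :=
  Finset.univ.filter (fun i => (K i).Nonempty)

theorem mem_support {n : ℕ+} {J : Fin n → Type} {K : ∀ i, Finset (J i)} {i : Fin n} :
    i ∈ support K ↔ (K i).Nonempty := by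
  simp [support]

/-- The recursive step of all inductions below: a set of leaves of the grafted tree is a family `K`,
the root sees only which `K i` are nonempty, and the branches are split independently. -/
theorem split_graft {n : ℕ+} (ω : V.carrier n) {J : Fin n → Type} (b : ∀ i, LTree V.carrier (J i))
    (K : ∀ i, Finset (J i)) :
    ((corolla n ω).graft b).split C V (Finset.univ.sigma K) =
      (corolla n (splitVec C V (support K) ω)).graft (fun i => (b i).branch C V (K i)) := by
  classical
  refine Subtype.ext ?_
  have hm : PTree.meet (Finset.univ.sigma K) (fun i => (b i).1.relabel (Sigma.mk i)) =
      support K := by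
    ext i
    simp only [PTree.mem_meet, PTree.leaves_relabel, List.mem_map, mem_support]
    constructor
    · rintro ⟨_, ⟨x, _, rfl⟩, h⟩
      exact ⟨x, by simpa using h⟩
    · rintro ⟨x, hx⟩
      exact ⟨⟨i, x⟩, ⟨x, (b i).2.2 x, rfl⟩, by simpa using hx⟩
  change splitTree C V _ (.node n ω (fun i => (b i).1.relabel (Sigma.mk i))) =
    .node n _ (fun i => ((b i).branch C V (K i)).1.relabel (Sigma.mk i))
  rw [splitTree, hm]
  congr 1
  funext i
  by_cases hi : (K i).Nonempty
  · rw [if_pos (mem_support.2 hi), branch, if_pos hi]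
    exact splitTree_relabel C V (Sigma.mk i) (by simp) (b i).1
  · rw [if_neg (mt mem_support.1 hi), branch, if_neg hi, starTree_eq_mapDeco]
    exact PTree.mapDeco_relabel _ _ _

end LTree

/-- A finite subset of a finite disjoint union is a family of finite subsets. -/
def sigmaFinsetEquiv {n : ℕ} (J : Fin n → Type) [∀ i, DecidableEq (J i)] :
    (∀ i, Finset (J i)) ≃ Finset (Σ i, J i) where
  toFun K := Finset.univ.sigma K
  invFun K i := K.preimage (Sigma.mk i) sigma_mk_injective.injOn
  left_inv K := by ext i x; simp
  right_inv K := by ext ⟨i, x⟩; simp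

theorem treeClass_split_graft {n : ℕ+} (ω : V.carrier n) {J : Fin n → Type} [∀ i, Finite (J i)]
    (b : ∀ i, LTree V.carrier (J i)) (K : ∀ i, Finset (J i)) :
    treeClass (splitModule C V) (((LTree.corolla n ω).graft b).split C V (Finset.univ.sigma K)) =
      (freeOperad (splitModule C V)).comp
        (freeIncl (splitModule C V) n (splitVec C V (LTree.support K) ω))
        (fun i => treeClass (splitModule C V) ((b i).branch C V (K i))) := by
  rw [LTree.split_graft, treeClass_graft]

/-! ### Expansion of starred trees, and vanishing for the arity configuration -/

/-- In the free operad, `CSp(t)` is the sum of all `CSp_J(t)`. -/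
theorem treeClass_star {X : Type} [Fintype X] (t : LTree V.carrier X) :
    treeClass (splitModule C V) (t.star C V) =
      ∑ J ∈ Finset.univ.filter (fun J : Finset X => J.Nonempty),
        treeClass (splitModule C V) (t.split C V J) := by
  classical
  refine LTree.induction (motive := fun X _ t => ∀ [Fintype X],
    treeClass (splitModule C V) (t.star C V) =
      ∑ J ∈ Finset.univ.filter (fun J : Finset X => J.Nonempty),
        treeClass (splitModule C V) (t.split C V J)) ?_ ?_ ?_ t
  · intro _
    have : Finset.univ.filter (fun J : Finset Unit => J.Nonempty) = {{()}} := by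
      ext J
      simp only [Finset.mem_filter, Finset.mem_univ, true_and, Finset.mem_singleton]
      exact ⟨fun h => Finset.eq_singleton_iff_nonempty_unique_mem.2 ⟨h, fun _ _ => rfl⟩,
        fun h => h ▸ Finset.singleton_nonempty _⟩
    rw [this, Finset.sum_singleton]
    rfl
  · intro X Y _ _ e t ih _
    let _ := Fintype.ofFinite X
    rw [LTree.star, LTree.mapDeco_relabel, treeClass_relabel]
    change (freeOperad _).map e (treeClass _ (t.star C V)) = _
    rw [ih, map_sum]
    refine Finset.sum_equiv (Equiv.finsetCongr e) (by simp) fun J _ => ?_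
    rw [← treeClass_relabel, ← LTree.split_relabel]
    rfl
  · intro n ω J _ b ih _
    let _ : ∀ i, Fintype (J i) := fun i => Fintype.ofFinite (J i)
    -- Once the root has chosen `I`, a branch over `i ∈ I` is expanded by induction. Over `i ∉ I`
    -- the only admissible `K` is `∅`, whose `branch` is the starred tree itself.
    have hbranch : ∀ (I : Finset (Fin n)) (i : Fin n),
        treeClass (splitModule C V) ((b i).star C V) =
          ∑ K ∈ Finset.univ.filter (fun K : Finset (J i) => K.Nonempty ↔ i ∈ I),
            treeClass (splitModule C V) ((b i).branch C V K) := by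
      intro I i
      by_cases hi : i ∈ I
      · rw [ih i]
        simp only [hi, iff_true]
        refine Finset.sum_congr rfl fun K hK => ?_
        rw [LTree.branch, if_pos (by simpa using hK)]
      · have : Finset.univ.filter (fun K : Finset (J i) => K.Nonempty ↔ i ∈ I) = {∅} := by
          ext K
          simp [hi]
        rw [this, Finset.sum_singleton, LTree.branch, if_neg Finset.not_nonempty_empty]
    -- Multilinearity of the composition turns the branchwise sums into one sum over families; the
    -- conditions on the single `K i` say together that the support is `I`.
    have hsum : ∀ I : Finset (Fin n),
        (freeOperad (splitModule C V)).comp (freeIncl (splitModule C V) n (splitVec C V I ω))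
          (fun i => treeClass (splitModule C V) ((b i).star C V)) =
        ∑ K ∈ Finset.univ.filter (fun K : ∀ i, Finset (J i) => LTree.support K = I),
          treeClass (splitModule C V)
            (((LTree.corolla n ω).graft b).split C V (Finset.univ.sigma K)) := by
      intro I
      rw [show (fun i => treeClass (splitModule C V) ((b i).star C V)) = _ from
        funext (hbranch I), MultilinearMap.map_sum_finset]
      refine Finset.sum_congr ?_ fun K hK => ?_
      · ext K
        simp [Fintype.mem_piFinset, Finset.ext_iff (s₁ := LTree.support K), LTree.mem_support]
      · have hK' : LTree.support K = I := by simpa using hK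
        rw [treeClass_split_graft, hK']
    have hstar : ((LTree.corolla n ω).graft b).star C V =
        (LTree.corolla n (splitStar C V ω)).graft (fun i => (b i).star C V) :=
      LTree.mapDeco_graft _ _ _
    rw [hstar, treeClass_graft, splitStar_eq_sum]
    simp only [LinearMap.sum_apply, map_sum, sum_apply, hsum]
    -- Summing over all `I` removes the constraint on the support, since each family has exactly
    -- one.
    rw [Finset.sum_fiberwise (s := Finset.univ) (g := LTree.support)]
    rw [← Finset.sum_subset (Finset.filter_subset
      (fun K : ∀ i, Finset (J i) => (Finset.univ.sigma K).Nonempty) _)]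
    · refine Finset.sum_equiv (sigmaFinsetEquiv J) (fun K => ?_) fun K _ => rfl
      simp only [Finset.mem_filter, Finset.mem_univ, true_and]
      rfl
    -- The family of empty sets has empty support, which is never in a configuration, so its root
    -- decoration is zero.
    · intro K _ hK
      rw [treeClass_split_graft, splitVec_of_notMem]
      · simp
      · intro h
        obtain ⟨i, hi⟩ := C.nonempty_of_mem h
        obtain ⟨x, hx⟩ := LTree.mem_support.1 hi
        have hx' : (⟨i, x⟩ : Σ i, J i) ∈ Finset.univ.sigma K := by simpa using hx
        exact hK (Finset.mem_filter.2 ⟨Finset.mem_univ _, ⟨_, hx'⟩⟩)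

/-- In the free operad, `ASp_J(t) = 0` if `J` has at least two elements. -/
theorem treeClass_split_arityConfig {X : Type} [Finite X] (t : LTree V.carrier X) (J : Finset X)
    (hJ : J.Nontrivial) : treeClass (splitModule arityConfig V) (t.split arityConfig V J) = 0 := by
  classical
  refine LTree.induction (motive := fun X _ t => ∀ J : Finset X, J.Nontrivial →
    treeClass (splitModule arityConfig V) (t.split arityConfig V J) = 0) ?_ ?_ ?_ t J hJ
  · rintro J ⟨x, _, y, _, h⟩
    exact absurd rfl h
  · intro X Y _ _ e t ih K hK
    obtain ⟨J, rfl⟩ := (Equiv.finsetCongr e).surjective K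
    have hJ : J.Nontrivial := by
      obtain ⟨x, hx, y, hy, h⟩ := hK
      simp only [Equiv.finsetCongr_apply, Finset.coe_map, Set.mem_image] at hx hy
      obtain ⟨x, hx, rfl⟩ := hx
      obtain ⟨y, hy, rfl⟩ := hy
      exact ⟨x, hx, y, hy, fun h' => h (h' ▸ rfl)⟩
    rw [Equiv.finsetCongr_apply, LTree.split_relabel, treeClass_relabel, ih J hJ, map_zero]
  · intro n ω J _ b ih K hK
    obtain ⟨K, rfl⟩ := (sigmaFinsetEquiv J).surjective K
    change treeClass _ (LTree.split _ _ (Finset.univ.sigma K) _) = 0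
    rw [treeClass_split_graft]
    -- Either all of the set lies above one input `i`, and the induction hypothesis kills that
    -- branch, or the root decoration is zero.
    by_cases h : LTree.support K ∈ arityConfig.sets n
    · obtain ⟨i, hi⟩ := h
      have hsup : ∀ j x, x ∈ K j → j = i := by
        intro j x hx
        have : j ∈ LTree.support K := LTree.mem_support.2 ⟨x, hx⟩
        simpa [hi] using this
      have hKi : (K i).Nontrivial := by
        obtain ⟨⟨j, x⟩, hx, ⟨j', y⟩, hy, h⟩ := hK
        replace hx : x ∈ K j := by simpa [sigmaFinsetEquiv] using hx
        replace hy : y ∈ K j' := by simpa [sigmaFinsetEquiv] using hy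
        obtain rfl := hsup _ _ hx
        obtain rfl := hsup _ _ hy
        exact ⟨x, hx, y, hy, fun h' => h (h' ▸ rfl)⟩
      refine MultilinearMap.map_coord_zero _ i ?_
      rw [LTree.branch, if_pos hKi.nonempty]
      exact ih i (K i) hKi
    · rw [splitVec_of_notMem _ V h]
      simp

/-! ### Images of the relations under the splitting maps -/

/-- The map `splitLin`, on the operations of the operad of decorated trees. -/
def splitOp {X : Type} [Finite X] (J : Finset X) :
    (treeOperad k V.carrier).obj X →ₗ[k] (treeOperad k (splitModule C V).carrier).obj X :=
  splitLin C V J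

theorem splitOp_treeOp {X : Type} [Finite X] (J : Finset X) (t : LTree V.carrier X) :
    splitOp C V J (treeOp k t) = treeOp k (t.split C V J) :=
  Finsupp.mapDomain_single

/-- Linear extension of `treeClass_star`. It reduces the question whether a relation dies to one
about each `CSp_J(r)` separately. -/
theorem proj_decorate_splitStar {X : Type} [Fintype X] (r : (treeOperad k V.carrier).obj X) :
    (freeProj (splitModule C V)).app X
        ((decorate k (fun _ => splitStar C V)).app X r) =
      ∑ J ∈ Finset.univ.filter (fun J : Finset X => J.Nonempty),
        (freeProj (splitModule C V)).app X (splitOp C V J r) := by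
  have h : (freeProj (splitModule C V)).app X ∘ₗ
      (decorate k (fun _ => splitStar C V)).app X =
      ∑ J ∈ Finset.univ.filter (fun J : Finset X => J.Nonempty),
        (freeProj (splitModule C V)).app X ∘ₗ splitOp C V J := by
    refine treeOperad_linear_ext fun t => ?_
    simp only [LinearMap.comp_apply, LinearMap.sum_apply, decorate_treeOp, splitOp_treeOp]
    exact treeClass_star C V t
  exact (congrArg (fun f => f r) h).trans (LinearMap.sum_apply _ _ _)

theorem proj_splitOp_arityConfig {X : Type} [Finite X] (J : Finset X) (hJ : J.Nontrivial)
    (r : (treeOperad k V.carrier).obj X) :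
    (freeProj (splitModule arityConfig V)).app X (splitOp arityConfig V J r) = 0 := by
  have h : (freeProj (splitModule arityConfig V)).app X ∘ₗ
      splitOp arityConfig V J = 0 := by
    refine treeOperad_linear_ext fun t => ?_
    rw [LinearMap.comp_apply, splitOp_treeOp, LinearMap.zero_apply]
    exact treeClass_split_arityConfig V t J hJ
  exact congrArg (fun f => f r) h

/-- The equality holds among combinations of planar trees, before any vertex relation is imposed. -/
theorem decorate_splitVec_univ {X : Type} [Fintype X] (r : (treeOperad k V.carrier).obj X) :
    (decorate k (fun _ => splitVec C V Finset.univ)).app X r = splitOp C V Finset.univ r := by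
  have h : (decorate k (fun _ => splitVec C V Finset.univ)).app X =
      splitOp C V (Finset.univ : Finset X) := by
    refine treeOperad_linear_ext fun t => ?_
    rw [decorate_treeOp, splitOp_treeOp]
    congr 1
    exact Subtype.ext (splitTree_univ C V t.1).symm
  exact congrArg (fun f => f r) h

theorem proj_splitOp_mem (R : Relations V) {n : ℕ+} {r : (treeOperad k V.carrier).obj (Fin n)}
    (hr : r ∈ relOps R n) {J : Finset (Fin n)} (hJ : J ∈ C.sets n) :
    (freeProj (splitModule C V)).app (Fin n) (splitOp C V J r) ∈
      (relIdeal (splitModule C V) (splitRel C V R)).sub (Fin n) :=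
  Operad.OpIdeal.subset_span _ n ⟨_, ⟨r, hr, J, hJ, rfl⟩, rfl⟩

theorem existsUnique_inducedBy (R : Relations V)
    (f : ∀ n : ℕ+, V.carrier n →ₗ[k] (splitModule C V).carrier n)
    (hf : ∀ (n : ℕ+) (σ : Equiv.Perm (Fin n)) (ω : V.carrier n),
      f n (V.act n σ ω) = (splitModule C V).act n σ (f n ω))
    (hR : ∀ (n : ℕ+), ∀ r ∈ relOps R n, (freeProj (splitModule C V)).app (Fin n)
      ((decorate k (fun n => f n)).app (Fin n) r) ∈
        (relIdeal (splitModule C V) (splitRel C V R)).sub (Fin n)) :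
    ∃! φ : Operad.Hom (presOperad V R) (splitOperad C V R), InducedBy C V R φ f := by
  obtain ⟨φ, hφ⟩ := exists_presOperad_hom R (splitRel C V R) f hf hR
  exact ⟨φ, hφ, fun ψ hψ => presOperad_hom_ext fun n ω => (hψ n ω).trans (hφ n ω).symm⟩

/-! ### Configurations below their index -/

/-- A configuration contains all nonempty sets in the arities below an arity where it does. -/
theorem Configuration.sets_eq_of_le (C : Configuration) {l n : ℕ+} (hln : l ≤ n)
    (hn : C.sets n = {J | J.Nonempty}) : C.sets l = {J | J.Nonempty} := by
  classical
  refine Set.Subset.antisymm (fun J hJ => C.nonempty_of_mem hJ) fun J hJ => ?_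
  obtain ⟨_ | l, hl⟩ := l
  · exact absurd hl (lt_irrefl 0)
  obtain ⟨n, hpos⟩ := n
  -- From here on the smaller arity is `l + 1` and the larger one `l + (d + 1)`. If the two agree
  -- then `d = 0`, and the upper vertex of the tree below is unary.
  obtain ⟨d, rfl⟩ : ∃ d, n = l + (d + 1) := (Nat.exists_eq_add_of_le hln).imp fun d hd => by
    change n = l + 1 + d at hd
    omega
  change Finset (Fin (l + 1)) at J
  let last : PTree (fun _ => Unit) (Fin (l + (d + 1))) :=
    .node ⟨d + 1, d.succ_pos⟩ () (fun j : Fin (d + 1) => .leaf (Fin.natAdd l j))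
  -- Branches of the test tree: `l` leaves, and a corolla at the last input that carries the
  -- remaining `d + 1` leaves.
  let c : Fin (l + 1) → PTree (fun _ => Unit) (Fin (l + (d + 1))) :=
    Fin.lastCases last (fun i => .leaf (Fin.castAdd (d + 1) i))
  have hlast : last.leaves = (List.finRange (d + 1)).map (Fin.natAdd l) :=
    List.flatMap_pure_eq_map _ _
  -- `g` sends a leaf to the root input below it. As `g` is onto, the preimage `K` of `J` meets the
  -- root exactly in `J`.
  let g : Fin (l + (d + 1)) → Fin (l + 1) := Fin.addCases Fin.castSucc (fun _ => Fin.last l)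
  let K : Finset (Fin (l + (d + 1))) := Finset.univ.filter (fun x => g x ∈ J)
  have hmeet : PTree.meet (n := ⟨l + 1, hl⟩) K c = J := by
    ext i
    refine PTree.mem_meet.trans ?_
    change Fin (l + 1) at i
    induction i using Fin.lastCases with
    | last => simp [K, c, g, hlast]; rfl
    | cast i => simp [K, c, g, PTree.leaves]; rfl
  have hleaves : (PTree.node (Ω := fun _ => Unit) ⟨l + 1, hl⟩ () c).leaves =
      List.finRange (l + (d + 1)) := by
    change (List.finRange (l + 1)).flatMap (fun i => (c i).leaves) = _
    -- Compared as lists of natural numbers, both sides are the range up to `l + (d + 1)`, split at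
    -- `l`.
    apply List.map_injective_iff.2 Fin.val_injective
    rw [List.finRange_succ_last, List.flatMap_append, List.flatMap_map]
    simp only [c, Fin.lastCases_castSucc, Fin.lastCases_last, PTree.leaves, hlast,
      List.flatMap_singleton]
    rw [show (List.finRange l).flatMap (fun i => [Fin.castAdd (d + 1) i]) =
      (List.finRange l).map (Fin.castAdd (d + 1)) from List.flatMap_pure_eq_map _ _,
      List.map_append, List.map_map, List.map_map, List.map_coe_finRange_eq_range,
      List.range_add, ← List.map_coe_finRange_eq_range, ← List.map_coe_finRange_eq_range,
      List.map_map]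
    rfl
  have key := C.meet_mem (n := ⟨l + (d + 1), hpos⟩)
    (J := K) (by
      rw [hn]
      obtain ⟨i, hi⟩ := hJ
      obtain ⟨x, _, hx⟩ := PTree.mem_meet.1 ((congrArg (i ∈ ·) hmeet).mpr hi)
      exact ⟨x, hx⟩) _ hleaves ⟨l + 1, hl⟩ c (.refl _) ((congrArg Finset.Nonempty hmeet).mpr hJ)
  exact (congrArg (· ∈ C.sets ⟨l + 1, hl⟩) hmeet).mp key

/-- If arity `n` lacked a nonempty set, so would all larger arities. Then `n - 1` would bound the
supremum `m`, contrary to `n ≤ m`. No maximum has to be attained, so `m = ⊤` needs no separate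
treatment. -/
theorem Configuration.IsIndex.sets_eq {C : Configuration} {m : ℕ∞} (hC : C.IsIndex m) {n : ℕ+}
    (hn : ((n : ℕ) : ℕ∞) ≤ m) : C.sets n = {J | J.Nonempty} := by
  by_contra hne
  have hub : m ≤ (((n : ℕ) - 1 : ℕ) : ℕ∞) := by
    refine hC.2.2 ?_
    rintro _ ⟨l, hl, rfl⟩
    have : ¬ n ≤ l := fun h => hne (C.sets_eq_of_le h hl)
    have h2 : (l : ℕ) < n := not_le.1 this
    exact_mod_cast Nat.le_sub_one_of_lt h2
  have h3 := hn.trans hub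
  have h4 : (n : ℕ) ≤ (n : ℕ) - 1 := by exact_mod_cast h3
  have := n.pos
  omega

end Splitting

end

/-! ### The theorem -/

theorem theorem4p3 {k : Type v} [Field k] (V : SModule.{u, v} k) (R : Relations V) :
    (∃! α : Operad.Hom (presOperad V R) (splitOperad arityConfig V R),
      InducedBy arityConfig V R α
        (fun n => ∑ i : Fin n, splitVec arityConfig V ({i} : Finset (Fin n)))) ∧
    ∀ (C : SymConfiguration) (m : ℕ∞), C.IsIndex m →
      (∀ n : ℕ+, (R n).Nonempty → ((n : ℕ) : ℕ∞) ≤ m) →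
      (∃! γ : Operad.Hom (presOperad V R) (splitOperad C V R),
        InducedBy C V R γ
          (fun n => ∑ I ∈ Finset.univ.filter (fun I : Finset (Fin n) => I.Nonempty),
            splitVec C V I)) ∧
      (∃! β : Operad.Hom (presOperad V R) (splitOperad C V R),
        InducedBy C V R β (fun n => splitVec C V (Finset.univ : Finset (Fin n)))) := by
  refine ⟨?_, fun C m hC hm => ⟨?_, ?_⟩⟩
  · simp only [← splitStar_arityConfig]
    refine existsUnique_inducedBy _ V R _ (fun n => splitStar_act _ V) fun n r hr => ?_
    rw [proj_decorate_splitStar]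
    refine Submodule.sum_mem _ fun J hJ => ?_
    -- A singleton gives one of the defining relations; a larger set contributes zero, so no bound
    -- on the arity of `r` is needed.
    rcases (by simpa using hJ : J.Nonempty).exists_eq_singleton_or_nontrivial with h | h
    · exact proj_splitOp_mem _ V R hr h
    · rw [proj_splitOp_arityConfig V J h]
      exact Submodule.zero_mem _
  · simp only [← splitStar_eq_sum_nonempty]
    refine existsUnique_inducedBy _ V R _ (fun n => splitStar_act _ V) fun n r hr => ?_
    rw [proj_decorate_splitStar]
    refine Submodule.sum_mem _ fun J hJ => proj_splitOp_mem _ V R hr ?_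
    rw [hC.sets_eq (hm n ⟨r, hr⟩)]
    simpa using hJ
  · refine existsUnique_inducedBy _ V R _ (fun n σ ω => ?_) fun n r hr => ?_
    · rw [← splitVec_act, Finset.map_univ_equiv]
    · rw [decorate_splitVec_univ]
      refine proj_splitOp_mem _ V R hr ?_
      rw [hC.sets_eq (hm n ⟨r, hr⟩)]
      -- The full set is nonempty because relations have positive arity.
      exact ⟨⟨0, n.pos⟩, Finset.mem_univ _⟩
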